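/- For every $c\in\mathbb N$ there is a constant $C=C(c)>0$ such that the following holds for every finite nonempty vertex set $V$, $|V|=n$, and all $\beta,\varepsilon\in(0,1]$. There is a randomized online algorithm for dynamic bipartite matching on $V$ with the following guarantee against an oblivious adversary. Let $G^0=(V,E^0)$ be any initial graph and let $\sigma$ be any sequence of $T$ updates, the $t$-th of which inserts an edge into or deletes an edge from $E^{t-1}$ and thereby gives $E^t$, such that all graphs $G^t=(V,E^t)$, $0\le t\le T$, are bipartite. The algorithm outputs edge sets $M^0=\emptyset,M^1,\dots,M^T$, where $M^t$ depends only on the random seed, on $G^0$ and on the first $t$ updates (the algorithm knows neither the later updates nor $T$; the seed is drawn independently of $\sigma$). Then $M^t$ is always a matching of $G^t$, $$\mathbb E\,|M^t|\ \ge\ (1-\varepsilon)\,\beta\cdot \mathrm{OPT}^t\qquad\text{for all }1\le t\le T,$$ and $$\mathbb E\Big[\sum_{t=1}^T |M^t\oplus M^{t-1}|\Big]\ \le\ \frac{C}{\varepsilon^{4}}\,\log n\,\log\frac n\varepsilon\cdot \mathrm{OPT}_R^\beta(\sigma)+\frac{T}{\varepsilon\, n^{c}} .$$ Here a fractional matching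 of $G^t$ is a vector $x\in\mathbb R_{\ge0}^{\binom V2}$ with $x_e=0$ for $e\notin E^t$ and $\sum_{e\ni v}x_e\le 1$ for every $v\in V$; its value is $\sum_e x_e$; $\mathrm{OPT}^t$ is the maximum value of a fractional matching of $G^t$; and $\mathrm{OPT}_R^\beta(\sigma)$ is the optimal offline recourse, that is, the infimum of $\sum_{t=1}^T\|x^t-x^{t-1}\|_1$ over all sequences with $x^0=0$ in which, for $1\le t\le T$, $x^t$ is a fractional matching of $G^t$ of value at least $\beta\cdot\mathrm{OPT}^t$. -/

import Mathlib

namespace DynMatching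

/-- An update to an edge set: a single edge is inserted or deleted.  Loops are never
edges of a simple graph, so inserting one has no effect. -/
inductive EdgeUpdate (V : Type*) where
  | insert (e : Sym2 V) : EdgeUpdate V
  | delete (e : Sym2 V) : EdgeUpdate V

/-- The graph after one update. -/
def EdgeUpdate.apply {V : Type*} (G : SimpleGraph V) : EdgeUpdate V → SimpleGraph V
  | .insert e => G ⊔ SimpleGraph.fromEdgeSet {e}
  | .delete e => G.deleteEdges {e}

/-- The current graph, after a list of updates has been applied to the initial graph `G₀`. -/
def currentGraph {V : Type*} (G₀ : SimpleGraph V) (σ : List (EdgeUpdate V)) : SimpleGraph V :=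
  σ.foldl EdgeUpdate.apply G₀

/-- The graph `G^t` at time `t`: the first `t` updates of `σ` have been applied. -/
def graphAt {V : Type*} (G₀ : SimpleGraph V) (σ : List (EdgeUpdate V)) (t : ℕ) : SimpleGraph V :=
  currentGraph G₀ (σ.take t)

/-- `M` is a matching of `G`: a set of edges no two of which share an endpoint. -/
def IsMatchingOf {V : Type*} (G : SimpleGraph V) (M : Finset (Sym2 V)) : Prop :=
  (∀ e ∈ M, e ∈ G.edgeSet) ∧ ∀ e ∈ M, ∀ f ∈ M, ∀ v : V, v ∈ e → v ∈ f → e = f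

section Fractional

variable {V : Type*} [Fintype V] [DecidableEq V]

/-- The fractional matchings of `G`, as vectors indexed by unordered pairs of vertices that
vanish off the edge set of `G`. -/
def fractionalMatchings (G : SimpleGraph V) : Set (Sym2 V → ℝ) :=
  {x | (∀ e, 0 ≤ x e) ∧ (∀ e, e ∉ G.edgeSet → x e = 0) ∧
    ∀ v : V, ∑ e : Sym2 V with v ∈ e, x e ≤ 1}

/-- The value (total weight) of a vector indexed by unordered pairs. -/
def value (x : Sym2 V → ℝ) : ℝ := ∑ e, x e

/-- The maximum value of a fractional matching of `G`. -/
noncomputable def opt (G : SimpleGraph V) : ℝ := sSup (value '' fractionalMatchings G)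

/-- The body of fractional matchings of `G` of value at least `β · opt G`. -/
def body (β : ℝ) (G : SimpleGraph V) : Set (Sym2 V → ℝ) :=
  {x | x ∈ fractionalMatchings G ∧ β * opt G ≤ value x}

/-- The total `ℓ₁`-movement of `x 0, x 1, …, x T`. -/
def movement (x : ℕ → Sym2 V → ℝ) (T : ℕ) : ℝ :=
  ∑ t ∈ Finset.range T, ∑ e, |x (t + 1) e - x t e|

/-- The offline solutions: sequences that start at `0` and at each time `1 ≤ t ≤ T` are a
fractional matching of `G^t` of value at least `β · opt G^t`. -/
def offlineSolutions (β : ℝ) (G₀ : SimpleGraph V) (σ : List (EdgeUpdate V)) :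
    Set (ℕ → Sym2 V → ℝ) :=
  {x | x 0 = 0 ∧ ∀ t, 1 ≤ t → t ≤ σ.length → x t ∈ body β (graphAt G₀ σ t)}

/-- The optimal offline recourse. -/
noncomputable def optRecourse (β : ℝ) (G₀ : SimpleGraph V) (σ : List (EdgeUpdate V)) : ℝ :=
  sInf ((fun x => movement x σ.length) '' offlineSolutions β G₀ σ)

end Fractional

/-- A randomized online algorithm which outputs a set of pairs of vertices after each update.
It draws a random seed `ω`; its output is then determined by the seed, the
initial graph and the updates that have been revealed so far.  It knows neither future updates
nor the length of the update sequence. -/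
structure RandomizedAlgorithm (V : Type*) where
  /-- The space of random seeds. -/
  Ω : Type
  [measurableSpace : MeasurableSpace Ω]
  /-- The distribution of the seed. -/
  μ : MeasureTheory.Measure Ω
  [isProbabilityMeasure : MeasureTheory.IsProbabilityMeasure μ]
  /-- The output for a seed, an initial graph and the updates revealed so far. -/
  output : Ω → SimpleGraph V → List (EdgeUpdate V) → Finset (Sym2 V)
  /-- Each possible output is an event. -/
  measurableSet_output : ∀ G₀ σ M, MeasurableSet {ω | output ω G₀ σ = M}

attribute [instance] RandomizedAlgorithm.measurableSpace
  RandomizedAlgorithm.isProbabilityMeasure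

namespace RandomizedAlgorithm

variable {V : Type*} (A : RandomizedAlgorithm V)

/-- The output `M^t` at time `t` of the run on the update sequence `σ` with seed `ω`. -/
def outputAt (ω : A.Ω) (G₀ : SimpleGraph V) (σ : List (EdgeUpdate V)) (t : ℕ) :
    Finset (Sym2 V) :=
  A.output ω G₀ (σ.take t)

/-- The expected size of `M^t`. -/
noncomputable def expectedSize (G₀ : SimpleGraph V) (σ : List (EdgeUpdate V)) (t : ℕ) : ℝ :=
  ∫ ω, ((A.outputAt ω G₀ σ t).card : ℝ) ∂A.μ

/-- The expected total recourse: the expectation of the sum over `1 ≤ t ≤ T` of the size of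
the symmetric difference of `M^{t-1}` and `M^t`. -/
noncomputable def expectedRecourse [DecidableEq V] (G₀ : SimpleGraph V)
    (σ : List (EdgeUpdate V)) : ℝ :=
  ∫ ω, ∑ t ∈ Finset.range σ.length,
    ((symmDiff (A.outputAt ω G₀ σ (t + 1)) (A.outputAt ω G₀ σ t)).card : ℝ) ∂A.μ

end RandomizedAlgorithm

end DynMatching

/-! The problem splits into fractional chasing and lossless-in-recourse rounding. Fix `η = ε / 8`.

Chasing: each new fractional point is the entropy projection, with coordinates shifted by `δ`, of
the old one onto the body relaxed from `β` to `(1 - η) * β`. The potential is the relative entropy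
of the offline point with respect to the online one. An offline move raises it by at most `log (1 +
1 / δ)` per unit of ℓ₁ movement. In the relaxed body one may mix the offline point with the online
point stripped of its increasing coordinates; testing optimality there (`upward_movement_le`) pays
for upward movement at rate `2 / η`, up to `δ` per coordinate. Starting from `0`, total movement is
at most twice upward movement (`movement_chase_le`).

Rounding: every pair draws one uniform threshold, kept forever, and is sampled with probability `min
1 (γ * x e)`. Shared thresholds make the expected change of the sample at most `γ` times the
fractional movement. For `γ` of order `log n / η ^ 2`, an exponential moment bound shows that the
reweighted sample carries nearly the value of `x` with degrees at most `1 + η`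
(`value_le_integral_of_sample`).

Integral matching: inside the sample the matching is repaired until no augmentation of at most `2 *
k + 1` changes remains, with `k` about `1 / η`. It is then nearly optimal
(`value_le_of_no_augment`), and matching size serves as a potential bounding recourse by `2 * k + 2`
times the sample's change (`sum_card_symmDiff_rematch_le`).

The factors `1 / η` (chasing), `1 / η ^ 2` (sampling) and `1 / η` (augmentation) give `1 / ε ^ 4`.
If `ε` is so small that the additive term exceeds the trivial recourse bound, recomputing a maximum
matching suffices. -/

namespace DynMatching

/-! ### Shifted relative entropy and its projections. -/

section Entropy

variable {ι : Type*} [Fintype ι]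

/-- The relative entropy (unnormalised Kullback-Leibler divergence) of `y + δ` with respect to
`x + δ`. -/
noncomputable def relEntropy (δ : ℝ) (y x : ι → ℝ) : ℝ :=
  ∑ e, ((y e + δ) * Real.log ((y e + δ) / (x e + δ)) - y e + x e)

lemma sub_le_mul_log_div {u v : ℝ} (hu : 0 < u) (hv : 0 < v) :
    u - v ≤ u * Real.log (u / v) := by
  have h := Real.log_le_sub_one_of_pos (div_pos hv hu)
  have h2 : Real.log (u / v) = -Real.log (v / u) := by
    rw [← Real.log_inv, inv_div]
  have h3 : u * (v / u - 1) = v - u := by field_simp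
  nlinarith [mul_le_mul_of_nonneg_left h hu.le]

lemma relEntropy_nonneg {δ : ℝ} (hδ : 0 < δ) {y x : ι → ℝ} (hy : ∀ e, 0 ≤ y e)
    (hx : ∀ e, 0 ≤ x e) : 0 ≤ relEntropy δ y x := by
  refine Finset.sum_nonneg fun e _ => ?_
  have := sub_le_mul_log_div (u := y e + δ) (v := x e + δ) (by linarith [hy e])
    (by linarith [hx e])
  linarith

lemma relEntropy_zero {δ : ℝ} (hδ : 0 < δ) : relEntropy δ (0 : ι → ℝ) 0 = 0 := by
  simp [relEntropy, div_self hδ.ne']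

/-- Convexity in the first argument: an increase is at most the slope at the new point times the
displacement. -/
lemma relEntropy_sub_le {δ : ℝ} (hδ : 0 < δ) {y y' x : ι → ℝ} (hy : ∀ e, 0 ≤ y e)
    (hy' : ∀ e, 0 ≤ y' e) (hx : ∀ e, 0 ≤ x e) :
    relEntropy δ y' x - relEntropy δ y x ≤
      ∑ e, Real.log ((y' e + δ) / (x e + δ)) * (y' e - y e) := by
  rw [relEntropy, relEntropy, ← Finset.sum_sub_distrib]
  refine Finset.sum_le_sum fun e _ => ?_
  have a : 0 < y e + δ := by linarith [hy e]
  have b : 0 < y' e + δ := by linarith [hy' e]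
  have c : 0 < x e + δ := by linarith [hx e]
  have := sub_le_mul_log_div a b
  rw [Real.log_div a.ne' b.ne'] at this
  rw [Real.log_div a.ne' c.ne', Real.log_div b.ne' c.ne']
  nlinarith

/-- Bregman identity. Its linear term is the gradient of `relEntropy δ · w` at `x`, the quantity
controlled by optimality of a projection. -/
lemma relEntropy_three_point {δ : ℝ} (hδ : 0 < δ) {y w x : ι → ℝ} (hy : ∀ e, 0 ≤ y e)
    (hw : ∀ e, 0 ≤ w e) (hx : ∀ e, 0 ≤ x e) :
    relEntropy δ y w - relEntropy δ y x =
      relEntropy δ x w + ∑ e, Real.log ((x e + δ) / (w e + δ)) * (y e - x e) := by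
  rw [relEntropy, relEntropy, relEntropy, ← Finset.sum_sub_distrib, ← Finset.sum_add_distrib]
  refine Finset.sum_congr rfl fun e _ => ?_
  have a : 0 < y e + δ := by linarith [hy e]
  have b : 0 < w e + δ := by linarith [hw e]
  have c : 0 < x e + δ := by linarith [hx e]
  rw [Real.log_div a.ne' c.ne', Real.log_div a.ne' b.ne', Real.log_div c.ne' b.ne']
  ring

/-- This is the purpose of the shift `δ`: gradients of the potential stay bounded even at zero
coordinates. -/
lemma abs_log_div_le {δ a b : ℝ} (hδ : 0 < δ) (ha : 0 ≤ a) (ha' : a ≤ 1) (hb : 0 ≤ b)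
    (hb' : b ≤ 1) : |Real.log ((a + δ) / (b + δ))| ≤ Real.log (1 + 1 / δ) := by
  have key : ∀ {a b : ℝ}, 0 ≤ a → a ≤ 1 → 0 ≤ b → b ≤ 1 →
      Real.log ((a + δ) / (b + δ)) ≤ Real.log (1 + 1 / δ) := by
    intro a b ha ha' hb hb'
    refine Real.log_le_log (by positivity) ?_
    rw [div_le_iff₀ (by positivity)]
    have : (1 + 1 / δ) * (b + δ) = b + δ + b / δ + 1 := by field_simp; ring
    rw [this]
    have : 0 ≤ b / δ := by positivity
    linarith
  refine abs_le.2 ⟨?_, key ha ha' hb hb'⟩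
  have := key hb hb' ha ha'
  rw [← inv_div, Real.log_inv] at this
  linarith

lemma relEntropy_sub_le_l1 {δ : ℝ} (hδ : 0 < δ) {y y' x : ι → ℝ} (hy : ∀ e, 0 ≤ y e)
    (hy' : ∀ e, 0 ≤ y' e) (hx : ∀ e, 0 ≤ x e) (hy'1 : ∀ e, y' e ≤ 1)
    (hx1 : ∀ e, x e ≤ 1) :
    relEntropy δ y' x - relEntropy δ y x ≤ Real.log (1 + 1 / δ) * ∑ e, |y' e - y e| := by
  refine (relEntropy_sub_le hδ hy hy' hx).trans ?_
  rw [Finset.mul_sum]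
  refine Finset.sum_le_sum fun e _ => ?_
  refine (le_abs_self _).trans ?_
  rw [abs_mul]
  exact mul_le_mul_of_nonneg_right (abs_log_div_le hδ (hy' e) (hy'1 e) (hx e) (hx1 e))
    (abs_nonneg _)

/-- The entropy projection onto a compact convex set exists, and satisfies the first-order
optimality condition. -/
lemma exists_entropy_projection {δ : ℝ} (hδ : 0 < δ) {K : Set (ι → ℝ)} (hK : IsCompact K)
    (hconv : Convex ℝ K) (hne : K.Nonempty) (hpos : ∀ x ∈ K, ∀ e, 0 ≤ x e) {w : ι → ℝ}
    (hw : ∀ e, 0 ≤ w e) :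
    ∃ x ∈ K, ∀ z ∈ K, 0 ≤ ∑ e, Real.log ((x e + δ) / (w e + δ)) * (z e - x e) := by
  have hcont : ContinuousOn (fun x : ι → ℝ => relEntropy δ x w) K := by
    refine continuousOn_finsetSum _ fun e _ => ?_
    have hc : ContinuousOn (fun x : ι → ℝ => x e) K := (continuous_apply e).continuousOn
    refine ((ContinuousOn.mul (hc.add continuousOn_const) (ContinuousOn.log
      ((hc.add continuousOn_const).div_const _) fun x hx => ?_)).sub hc).add continuousOn_const
    exact (div_pos (add_pos_of_nonneg_of_pos (hpos x hx e) hδ)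
      (add_pos_of_nonneg_of_pos (hw e) hδ)).ne'
  obtain ⟨x, hxK, hmin⟩ := hK.exists_isMinOn hne hcont
  refine ⟨x, hxK, fun z hz => ?_⟩
  -- Points on the segment from `x` to `z`. Minimality and the convexity bound give the inequality
  -- with the gradient taken at `p s`; letting `s` tend to `0` moves it to `x`, with no
  -- differentiation needed.
  let p : ℝ → ι → ℝ := fun s e => x e + s * (z e - x e)
  have hpK : ∀ s, 0 < s → s ≤ 1 → p s ∈ K := by
    intro s hs hs1
    have := hconv hxK hz (a := 1 - s) (b := s) (by linarith) hs.le (by ring)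
    convert this using 1
    funext e
    simp only [p, Pi.add_apply, Pi.smul_apply, smul_eq_mul]
    ring
  have hineq : ∀ s, 0 < s → s ≤ 1 →
      0 ≤ ∑ e, Real.log ((p s e + δ) / (w e + δ)) * (z e - x e) := by
    intro s hs hs1
    have h1 := relEntropy_sub_le hδ (hpos x hxK) (hpos _ (hpK s hs hs1)) hw
    have h2 : relEntropy δ x w ≤ relEntropy δ (p s) w := hmin (hpK s hs hs1)
    have h3 : ∑ e, Real.log ((p s e + δ) / (w e + δ)) * (p s e - x e) =
        s * ∑ e, Real.log ((p s e + δ) / (w e + δ)) * (z e - x e) := by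
      rw [Finset.mul_sum]
      refine Finset.sum_congr rfl fun e _ => ?_
      simp only [p]
      ring
    rw [h3] at h1
    exact nonneg_of_mul_nonneg_right (by linarith) hs
  have hlim : Filter.Tendsto
      (fun s => ∑ e, Real.log ((p s e + δ) / (w e + δ)) * (z e - x e))
      (nhdsWithin 0 (Set.Ioi 0))
      (nhds (∑ e, Real.log ((x e + δ) / (w e + δ)) * (z e - x e))) := by
    refine tendsto_finsetSum _ fun e _ => ?_
    refine Filter.Tendsto.mul_const _ ?_
    have hx0 : 0 < x e + δ := by linarith [hpos x hxK e]
    have hw0 : 0 < w e + δ := by linarith [hw e]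
    have hc : ContinuousAt (fun s => Real.log ((p s e + δ) / (w e + δ))) 0 := by
      refine ContinuousAt.log (by simp only [p]; fun_prop) ?_
      simp only [p, zero_mul, add_zero]
      positivity
    have := hc.tendsto.mono_left (nhdsWithin_le_nhds (s := Set.Ioi 0))
    simpa [p] using this
  refine ge_of_tendsto hlim ?_
  filter_upwards [Ioc_mem_nhdsGT (show (0 : ℝ) < 1 by norm_num)] with s hs
  exact hineq s hs.1 hs.2

end Entropy

/-! ### Amortized bound on the movement. -/

section Movement

variable {V : Type*} [Fintype V]

lemma continuous_value : Continuous (value : (Sym2 V → ℝ) → ℝ) := by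
  unfold value
  fun_prop

/-- Amortization: since `|d| + d = 2 * max d 0`, movement plus current mass is twice the upward
movement, and the entropy potential absorbs the latter. Final mass and potential are nonnegative and
can be dropped. -/
lemma movement_le_of_relEntropy {δ L κ R : ℝ} (hκ : 0 ≤ κ) {x y : ℕ → Sym2 V → ℝ} {T : ℕ}
    (hx0 : x 0 = 0) (hy0 : y 0 = 0) (hδ : 0 < δ)
    (hxT : ∀ t ≤ T, ∀ e, 0 ≤ x t e) (hyT : ∀ t ≤ T, ∀ e, 0 ≤ y t e)
    (hy : ∀ t < T, relEntropy δ (y (t + 1)) (x t) - relEntropy δ (y t) (x t) ≤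
      L * ∑ e, |y (t + 1) e - y t e|)
    (hx : ∀ t < T, ∑ e, max (x (t + 1) e - x t e) 0 ≤
      κ * (relEntropy δ (y (t + 1)) (x t) - relEntropy δ (y (t + 1)) (x (t + 1))) + R) :
    movement x T ≤ 2 * (κ * L * movement y T + T * R) := by
  have key : ∀ t ≤ T, movement x t + ∑ e, x t e + 2 * κ * relEntropy δ (y t) (x t) ≤
      2 * (κ * L * movement y t + t * R) := by
    intro t
    induction t with
    | zero => simp [movement, hx0, hy0, relEntropy_zero hδ]
    | succ t ih =>
      intro ht
      have ih := ih (by omega)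
      have h1 := mul_le_mul_of_nonneg_left (hy t (by omega)) hκ
      have h2 := hx t (by omega)
      have h3 : ∑ e, |x (t + 1) e - x t e| + (∑ e, x (t + 1) e - ∑ e, x t e) =
          2 * ∑ e, max (x (t + 1) e - x t e) 0 := by
        rw [← Finset.sum_sub_distrib, ← Finset.sum_add_distrib, Finset.mul_sum]
        refine Finset.sum_congr rfl fun e _ => ?_
        rcases le_total 0 (x (t + 1) e - x t e) with h | h
        · rw [abs_of_nonneg h, max_eq_left h]; ring
        · rw [abs_of_nonpos h, max_eq_right h]; ring
      simp only [movement, Finset.sum_range_succ] at ih ⊢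
      push_cast
      nlinarith
  have h1 := key T le_rfl
  have h2 := relEntropy_nonneg hδ (hyT T le_rfl) (hxT T le_rfl)
  have h3 : 0 ≤ ∑ e, x T e := Finset.sum_nonneg fun e _ => hxT T le_rfl e
  have : 0 ≤ 2 * κ * relEntropy δ (y T) (x T) := by positivity
  linarith

end Movement

/-! ### Chasing the bodies of near-optimal fractional matchings. -/

section Chasing

variable {V : Type*} [Fintype V] [DecidableEq V] {G : SimpleGraph V}

lemma fractionalMatchings_le_one {x : Sym2 V → ℝ} (hx : x ∈ fractionalMatchings G) (e : Sym2 V) :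
    x e ≤ 1 := by
  induction e with
  | h u v =>
    refine le_trans ?_ (hx.2.2 u)
    exact Finset.single_le_sum (f := x) (fun e _ => hx.1 e) (by simp)

lemma zero_mem_fractionalMatchings : (0 : Sym2 V → ℝ) ∈ fractionalMatchings G :=
  ⟨fun _ => le_rfl, fun _ _ => rfl, fun v => by simp⟩

lemma fractionalMatchings_of_le {x y : Sym2 V → ℝ} (hx : x ∈ fractionalMatchings G)
    (h0 : ∀ e, 0 ≤ y e) (h : ∀ e, y e ≤ x e) : y ∈ fractionalMatchings G :=
  ⟨h0, fun e he => le_antisymm ((h e).trans (hx.2.1 e he).le) (h0 e),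
    fun v => (Finset.sum_le_sum fun e _ => h e).trans (hx.2.2 v)⟩

lemma convex_fractionalMatchings : Convex ℝ (fractionalMatchings G) := by
  intro x hx y hy a b ha hb hab
  refine ⟨fun e => ?_, fun e he => ?_, fun v => ?_⟩
  · have := hx.1 e
    have := hy.1 e
    simp only [Pi.add_apply, Pi.smul_apply, smul_eq_mul]
    positivity
  · simp [hx.2.1 e he, hy.2.1 e he]
  · simp only [Pi.add_apply, Pi.smul_apply, smul_eq_mul, Finset.sum_add_distrib,
      ← Finset.mul_sum]
    nlinarith [hx.2.2 v, hy.2.2 v]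

lemma isCompact_fractionalMatchings : IsCompact (fractionalMatchings G) := by
  have hb : fractionalMatchings G ⊆ Set.Icc 0 1 :=
    fun x hx => ⟨hx.1, fractionalMatchings_le_one hx⟩
  refine isCompact_Icc.of_isClosed_subset ?_ hb
  have : fractionalMatchings G = (⋂ e, {x | 0 ≤ x e}) ∩
      ((⋂ e, ⋂ (_ : e ∉ G.edgeSet), {x | x e = 0}) ∩
        ⋂ v : V, {x | ∑ e : Sym2 V with v ∈ e, x e ≤ 1}) := by
    ext x
    simp [fractionalMatchings]
  rw [this]
  refine (isClosed_iInter fun e => isClosed_le continuous_const (continuous_apply e)).inter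
    ((isClosed_iInter fun e => isClosed_iInter fun _ =>
      isClosed_eq (continuous_apply e) continuous_const).inter
      (isClosed_iInter fun v => isClosed_le ?_ continuous_const))
  fun_prop

lemma exists_value_eq_opt (G : SimpleGraph V) :
    ∃ x ∈ fractionalMatchings G, value x = opt G :=
  (isCompact_fractionalMatchings.image continuous_value).sSup_mem
    ⟨_, 0, zero_mem_fractionalMatchings, rfl⟩

lemma opt_nonneg (G : SimpleGraph V) : 0 ≤ opt G := by
  obtain ⟨x, hx, h⟩ := exists_value_eq_opt G
  exact h ▸ Finset.sum_nonneg fun e _ => hx.1 e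

lemma body_nonempty {β : ℝ} (hβ : β ≤ 1) (G : SimpleGraph V) : (body β G).Nonempty := by
  obtain ⟨x, hx, h⟩ := exists_value_eq_opt G
  exact ⟨x, hx, by rw [h]; nlinarith [opt_nonneg G]⟩

lemma isCompact_body (β : ℝ) (G : SimpleGraph V) : IsCompact (body β G) :=
  isCompact_fractionalMatchings.inter_right (isClosed_le continuous_const continuous_value)

lemma convex_body (β : ℝ) (G : SimpleGraph V) : Convex ℝ (body β G) := by
  intro x hx y hy a b ha hb hab
  refine ⟨convex_fractionalMatchings hx.1 hy.1 ha hb hab, ?_⟩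
  have : value (a • x + b • y) = a * value x + b * value y := by
    simp [value, Finset.sum_add_distrib, ← Finset.mul_sum]
  have h1 := mul_le_mul_of_nonneg_left hx.2 ha
  have h2 := mul_le_mul_of_nonneg_left hy.2 hb
  rw [this]
  calc β * opt G = a * (β * opt G) + b * (β * opt G) := by rw [← add_mul, hab, one_mul]
    _ ≤ _ := add_le_add h1 h2

open Classical in
/-- The entropy projection of `w` onto the relaxed body. -/
noncomputable def chaseStep (δ β η : ℝ) (w : Sym2 V → ℝ) (G : SimpleGraph V) : Sym2 V → ℝ :=
  -- The default `0` is not reached for nonnegative `w` under the parameter hypotheses of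
  -- `chaseStep_spec`.
  if h : ∃ x ∈ body ((1 - η) * β) G, ∀ z ∈ body ((1 - η) * β) G,
    0 ≤ ∑ e, Real.log ((x e + δ) / (w e + δ)) * (z e - x e) then h.choose else 0

lemma chaseStep_spec {δ β η : ℝ} (hδ : 0 < δ) (hβ0 : 0 ≤ β) (hβ : β ≤ 1) (hη : 0 ≤ η)
    {w : Sym2 V → ℝ} (hw : ∀ e, 0 ≤ w e) (G : SimpleGraph V) :
    chaseStep δ β η w G ∈ body ((1 - η) * β) G ∧ ∀ z ∈ body ((1 - η) * β) G,
      0 ≤ ∑ e, Real.log ((chaseStep δ β η w G e + δ) / (w e + δ)) *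
        (z e - chaseStep δ β η w G e) := by
  have h : ∃ x ∈ body ((1 - η) * β) G, ∀ z ∈ body ((1 - η) * β) G,
      0 ≤ ∑ e, Real.log ((x e + δ) / (w e + δ)) * (z e - x e) :=
    exists_entropy_projection hδ (isCompact_body _ G) (convex_body _ G)
      (body_nonempty (by nlinarith) G) (fun x hx => hx.1.1) hw
  rw [chaseStep, dif_pos h]
  exact h.choose_spec

/-- The upward movement of an entropy projection is paid for by the decrease of the relative
entropy of any point in the unrelaxed body. -/
lemma upward_movement_le {δ β η : ℝ} (hδ : 0 < δ) (hη0 : 0 < η) (hη : η < 1)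
    {w x y : Sym2 V → ℝ} (hw : ∀ e, 0 ≤ w e) (hx : x ∈ body ((1 - η) * β) G)
    (hopt : ∀ z ∈ body ((1 - η) * β) G,
      0 ≤ ∑ e, Real.log ((x e + δ) / (w e + δ)) * (z e - x e))
    (hy : y ∈ body β G) :
    ∑ e, max (x e - w e) 0 ≤ 2 / η * (relEntropy δ y w - relEntropy δ y x) +
      Fintype.card (Sym2 V) * δ := by
  set g : Sym2 V → ℝ := fun e => Real.log ((x e + δ) / (w e + δ)) with hg
  -- The test point keeps a `1 - η` share of `y`, hence enough value, and spends the remaining `η`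
  -- on the part of `x` where `g < 0`. On coordinates with `g ≥ 0` it lies below `x` by an extra `η
  -- * x e`, which yields the gain.
  let z : Sym2 V → ℝ := fun e => (1 - η) * y e + η * (if g e < 0 then x e else 0)
  have hz : z ∈ body ((1 - η) * β) G := by
    have h1 : (fun e => if g e < 0 then x e else 0) ∈ fractionalMatchings G := by
      refine fractionalMatchings_of_le hx.1 (fun e => ?_) (fun e => ?_)
      · have := hx.1.1 e
        split_ifs <;> simp [this]
      · have := hx.1.1 e
        split_ifs <;> simp [this]
    refine ⟨convex_fractionalMatchings hy.1 h1 (by linarith) hη0.le (by ring), ?_⟩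
    have h2 : (1 - η) * value y ≤ value z := by
      rw [value, value, Finset.mul_sum]
      refine Finset.sum_le_sum fun e _ => ?_
      have := mul_nonneg hη0.le (h1.1 e)
      simp only [z]
      linarith
    have h3 := mul_le_mul_of_nonneg_left hy.2 (show 0 ≤ 1 - η by linarith)
    linarith
  have h1 : ∀ e, g e * (z e - x e) = (1 - η) * (g e * (y e - x e)) - η * (x e * max (g e) 0) := by
    intro e
    simp only [z]
    split_ifs with h
    · rw [max_eq_right h.le]; ring
    · rw [max_eq_left (not_lt.1 h)]; ring
  have h2 := hopt z hz
  rw [Finset.sum_congr rfl fun e _ => h1 e, Finset.sum_sub_distrib, ← Finset.mul_sum,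
    ← Finset.mul_sum] at h2
  have h3 := relEntropy_three_point hδ hy.1.1 hw hx.1.1
  have h4 := relEntropy_nonneg hδ hx.1.1 hw
  have hup : 0 ≤ ∑ e, x e * max (g e) 0 :=
    Finset.sum_nonneg fun e _ => mul_nonneg (hx.1.1 e) (le_max_right _ _)
  have h5 : η * ∑ e, x e * max (g e) 0 ≤ relEntropy δ y w - relEntropy δ y x := by
    have h6 : η * ∑ e, x e * max (g e) 0 ≤ (1 - η) * ∑ e, g e * (y e - x e) := by linarith
    have h7 : 0 ≤ ∑ e, g e * (y e - x e) := by
      have : 0 ≤ η * ∑ e, x e * max (g e) 0 := by positivity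
      exact nonneg_of_mul_nonneg_right (this.trans h6) (by linarith)
    nlinarith
  have h8 : ∑ e, max (x e - w e) 0 ≤ ∑ e, (2 * (x e * max (g e) 0) + δ) := by
    refine Finset.sum_le_sum fun e _ => ?_
    have hxe := hx.1.1 e
    have hwe := hw e
    have hg0 := le_max_right (g e) 0
    have hg1 := le_max_left (g e) 0
    have hm : 0 ≤ x e * max (g e) 0 := mul_nonneg hxe hg0
    refine max_le ?_ (by linarith)
    -- If `δ ≤ x e`, then `x e + δ ≤ 2 * x e`, the source of the factor `2`. Otherwise the
    -- coordinate can rise by at most `δ`.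
    rcases le_total δ (x e) with h | h
    · have := sub_le_mul_log_div (u := x e + δ) (v := w e + δ) (by linarith) (by linarith)
      have h9 : (x e + δ) * g e ≤ (x e + x e) * max (g e) 0 :=
        (mul_le_mul_of_nonneg_left hg1 (by linarith)).trans
          (mul_le_mul_of_nonneg_right (by linarith) hg0)
      simp only [hg] at h9 ⊢
      linarith
    · linarith
  refine h8.trans ?_
  rw [Finset.sum_add_distrib, ← Finset.mul_sum]
  simp only [Finset.sum_const, Finset.card_univ, nsmul_eq_mul]
  refine add_le_add_left ?_ _
  rw [div_mul_eq_mul_div, le_div_iff₀ hη0]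
  linarith

lemma offlineSolutions_nonempty {β : ℝ} (hβ : β ≤ 1) (G₀ : SimpleGraph V)
    (σ : List (EdgeUpdate V)) : (offlineSolutions β G₀ σ).Nonempty := by
  refine ⟨fun t => if t = 0 then 0 else (body_nonempty hβ (graphAt G₀ σ t)).some, by simp,
    fun t ht _ => ?_⟩
  simp only [if_neg (show t ≠ 0 by omega)]
  exact (body_nonempty hβ (graphAt G₀ σ t)).some_mem

lemma optRecourse_nonneg (β : ℝ) (G₀ : SimpleGraph V) (σ : List (EdgeUpdate V)) :
    0 ≤ optRecourse β G₀ σ := by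
  refine Real.sInf_nonneg ?_
  rintro _ ⟨x, -, rfl⟩
  exact Finset.sum_nonneg fun t _ => Finset.sum_nonneg fun e _ => abs_nonneg _

/-- Iterated entropy projections have competitive movement. -/
theorem movement_chase_le {δ β η : ℝ} (hδ : 0 < δ) (hβ0 : 0 ≤ β) (hβ : β ≤ 1) (hη0 : 0 < η)
    (hη : η < 1) (G₀ : SimpleGraph V) (σ : List (EdgeUpdate V)) {x : ℕ → Sym2 V → ℝ}
    (hx0 : x 0 = 0)
    (hx : ∀ t < σ.length, x (t + 1) = chaseStep δ β η (x t) (graphAt G₀ σ (t + 1))) :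
    movement x σ.length ≤ 2 * (2 / η * Real.log (1 + 1 / δ) * optRecourse β G₀ σ +
      σ.length * (Fintype.card (Sym2 V) * δ)) := by
  have hfm : ∀ t ≤ σ.length, x t ∈ fractionalMatchings (graphAt G₀ σ t) := by
    intro t
    induction t with
    | zero => intro _; rw [hx0]; exact zero_mem_fractionalMatchings
    | succ t ih =>
      intro ht
      rw [hx t (by omega)]
      exact (chaseStep_spec hδ hβ0 hβ hη0.le (ih (by omega)).1 _).1.1
  have hL : 0 ≤ Real.log (1 + 1 / δ) := Real.log_nonneg (by
    have : 0 < 1 / δ := by positivity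
    linarith)
  have key : ∀ y ∈ offlineSolutions β G₀ σ, movement x σ.length ≤
      2 * (2 / η * Real.log (1 + 1 / δ) * movement y σ.length +
        σ.length * (Fintype.card (Sym2 V) * δ)) := by
    intro y hy
    have hyfm : ∀ t ≤ σ.length, y t ∈ fractionalMatchings (graphAt G₀ σ t) := by
      intro t ht
      rcases Nat.eq_zero_or_pos t with rfl | h
      · rw [hy.1]; exact zero_mem_fractionalMatchings
      · exact (hy.2 t h ht).1
    refine movement_le_of_relEntropy (by positivity) hx0 hy.1 hδ (fun t ht => (hfm t ht).1)
      (fun t ht => (hyfm t ht).1) (fun t ht => ?_) (fun t ht => ?_)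
    · exact relEntropy_sub_le_l1 hδ (hyfm t ht.le).1 (hyfm (t + 1) ht).1 (hfm t ht.le).1
        (fractionalMatchings_le_one (hyfm (t + 1) ht))
        (fractionalMatchings_le_one (hfm t ht.le))
    · have hs := chaseStep_spec hδ hβ0 hβ hη0.le (hfm t ht.le).1 (graphAt G₀ σ (t + 1))
      rw [← hx t ht] at hs
      exact upward_movement_le hδ hη0 hη (hfm t ht.le).1 hs.1 hs.2 (hy.2 (t + 1) (by omega) ht)
  have hκ : 0 ≤ 2 / η * Real.log (1 + 1 / δ) := by positivity
  have hne := (offlineSolutions_nonempty hβ G₀ σ).image (fun x => movement x σ.length)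
  rcases hκ.eq_or_lt with h0 | hpos
  · obtain ⟨y, hy⟩ := offlineSolutions_nonempty hβ G₀ σ
    have := key y hy
    rw [← h0] at this ⊢
    linarith
  -- The bound is turned into a lower bound on every offline movement, so that it passes to the
  -- infimum.
  · have : (movement x σ.length / 2 - σ.length * (Fintype.card (Sym2 V) * δ)) /
        (2 / η * Real.log (1 + 1 / δ)) ≤ optRecourse β G₀ σ := by
      refine le_csInf hne ?_
      rintro _ ⟨y, hy, rfl⟩
      rw [div_le_iff₀ hpos]
      linarith [key y hy]
    rw [div_le_iff₀ hpos] at this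
    linarith

end Chasing

/-! ### Short augmenting paths in bipartite graphs. -/

section Augment

variable {V : Type*}

/-- `M` is a set of pairwise vertex-disjoint elements of `H`. -/
def IsMatchingIn (H M : Finset (Sym2 V)) : Prop :=
  M ⊆ H ∧ ∀ e ∈ M, ∀ f ∈ M, ∀ v : V, v ∈ e → v ∈ f → e = f

lemma isMatchingIn_empty (H : Finset (Sym2 V)) : IsMatchingIn H ∅ :=
  ⟨Finset.empty_subset _, by simp⟩

/-- Every pair in `H` has exactly one endpoint in `L`. -/
def IsSplitBy (L : Finset V) (H : Finset (Sym2 V)) : Prop :=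
  ∀ a b : V, s(a, b) ∈ H → (a ∈ L ↔ b ∉ L)

lemma exists_isSplitBy [Fintype V] {G : SimpleGraph V} (hG : G.IsBipartite) :
    ∃ L : Finset V, ∀ H : Finset (Sym2 V), (∀ e ∈ H, e ∈ G.edgeSet) → IsSplitBy L H := by
  obtain ⟨col⟩ := hG
  refine ⟨Finset.univ.filter fun v => col v = 0, fun H hH a b hab => ?_⟩
  have h : col a ≠ col b := col.valid (hH _ hab)
  simp only [Finset.mem_filter, Finset.mem_univ, true_and]
  omega

variable [DecidableEq V]

lemma card_symmDiff_insert_le (e : Sym2 V) (A B : Finset (Sym2 V)) :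
    (symmDiff (insert e A) B).card ≤ (symmDiff A B).card + 1 := by
  refine (Finset.card_le_card (t := insert e (symmDiff A B)) ?_).trans (Finset.card_insert_le _ _)
  intro f
  simp only [Finset.mem_symmDiff, Finset.mem_insert]
  tauto

lemma card_symmDiff_erase_le (e : Sym2 V) (A B : Finset (Sym2 V)) :
    (symmDiff (A.erase e) B).card ≤ (symmDiff A B).card + 1 := by
  refine (Finset.card_le_card (t := insert e (symmDiff A B)) ?_).trans (Finset.card_insert_le _ _)
  intro f
  simp only [Finset.mem_symmDiff, Finset.mem_insert, Finset.mem_erase]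
  tauto

lemma IsMatchingIn.inter {H M : Finset (Sym2 V)} (hM : IsMatchingIn H M)
    (H' : Finset (Sym2 V)) : IsMatchingIn H' (M ∩ H') :=
  ⟨Finset.inter_subset_right, fun e he f hf v hev hfv =>
    hM.2 e (Finset.mem_inter.1 he).1 f (Finset.mem_inter.1 hf).1 v hev hfv⟩

lemma IsMatchingIn.insert_free {H M : Finset (Sym2 V)} (hM : IsMatchingIn H M) {a b : V}
    (hab : s(a, b) ∈ H) (ha : ∀ e ∈ M, a ∉ e) (hb : ∀ e ∈ M, b ∉ e) :
    IsMatchingIn H (insert s(a, b) M) ∧ (insert s(a, b) M).card = M.card + 1 := by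
  have cross : ∀ f ∈ M, ∀ v, v ∈ s(a, b) → v ∉ f := by
    intro f hf v hv
    rcases Sym2.mem_iff.1 hv with rfl | rfl
    · exact ha f hf
    · exact hb f hf
  refine ⟨⟨Finset.insert_subset hab hM.1, ?_⟩,
    Finset.card_insert_of_notMem fun h => ha _ h (by simp)⟩
  intro e he f hf v hev hfv
  rcases Finset.mem_insert.1 he with rfl | he' <;> rcases Finset.mem_insert.1 hf with rfl | hf'
  · rfl
  · exact absurd hfv (cross f hf' v hev)
  · exact absurd hev (cross e he' v hfv)
  · exact hM.2 e he' f hf' v hev hfv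

/-- Two vertices on the same side cannot share an edge, so choosing a matching edge at each vertex
is injective. -/
lemma card_le_of_covered {H M : Finset (Sym2 V)} {L S : Finset V} (hL : IsSplitBy L H) (hM : IsMatchingIn H M)
    (hside : (∀ v ∈ S, v ∈ L) ∨ ∀ v ∈ S, v ∉ L) (hS : ∀ v ∈ S, ∃ e ∈ M, v ∈ e) :
    S.card ≤ M.card := by
  rcases S.eq_empty_or_nonempty with rfl | ⟨v₀, -⟩
  · simp
  have : Nonempty (Sym2 V) := ⟨s(v₀, v₀)⟩
  choose! f hf hvf using hS
  refine Finset.card_le_card_of_injOn f hf fun v hv w hw hvw => ?_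
  by_contra hne
  have he : f v = s(v, w) := by
    refine (Sym2.mem_and_mem_iff hne).1 ⟨hvf v hv, ?_⟩
    simp only [hvw]
    exact hvf w hw
  have := hL v w (he ▸ hM.1 (hf v hv))
  rcases hside with h | h
  · exact this.1 (h v hv) (h w hw)
  · exact h v hv (this.2 (h w hw))

/-- The vertices of `L` that are free, or matched into `S`. -/
def leftOf (L : Finset V) (M : Finset (Sym2 V)) (S : Finset V) : Finset V :=
  {a ∈ L | (∀ e ∈ M, a ∉ e) ∨ ∃ b ∈ S, s(a, b) ∈ M}

lemma mem_leftOf {L : Finset V} {M : Finset (Sym2 V)} {S : Finset V} {a : V} :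
    a ∈ leftOf L M S ↔ a ∈ L ∧ ((∀ e ∈ M, a ∉ e) ∨ ∃ b ∈ S, s(a, b) ∈ M) :=
  Finset.mem_filter

/-- The matching partners of `S` are distinct, lie in `L`, and are disjoint from the free vertices
of `L`. -/
lemma card_leftOf_ge {L : Finset V} {H M : Finset (Sym2 V)} (hL : IsSplitBy L H) (hM : IsMatchingIn H M) {S : Finset V}
    (hS : ∀ b ∈ S, b ∉ L) (hcov : ∀ b ∈ S, ∃ e ∈ M, b ∈ e) :
    (leftOf L M ∅).card + S.card ≤ (leftOf L M S).card := by
  have hp : ∀ b ∈ S, ∃ a, s(a, b) ∈ M := by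
    intro b hb
    obtain ⟨e, he, hbe⟩ := hcov b hb
    obtain ⟨a, rfl⟩ := Sym2.mem_iff_exists.1 hbe
    exact ⟨a, by rwa [Sym2.eq_swap]⟩
  choose! p hp using hp
  have hinj : Set.InjOn p S := by
    intro b hb b' hb' h
    have h1 := hp b hb
    have h2 := hp b' hb'
    have h3 := hM.2 _ h1 _ h2 (p b) (by simp) (by simp [h])
    rcases Sym2.eq_iff.1 h3 with h4 | h4
    · exact h4.2
    · exact h4.2.trans (h.symm.trans h4.1)
  have hdisj : Disjoint (leftOf L M ∅) (S.image p) := by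
    rw [Finset.disjoint_left]
    intro a ha ha'
    obtain ⟨b, hb, rfl⟩ := Finset.mem_image.1 ha'
    have := (mem_leftOf.1 ha).2
    simp only [Finset.notMem_empty, false_and, exists_false, or_false] at this
    exact this _ (hp b hb) (by simp)
  rw [← Finset.card_image_of_injOn hinj, ← Finset.card_union_of_disjoint hdisj]
  refine Finset.card_le_card (Finset.union_subset ?_ ?_)
  · intro a ha
    have := mem_leftOf.1 ha
    exact mem_leftOf.2 ⟨this.1, Or.inl (by simpa using this.2)⟩
  · intro a ha
    obtain ⟨b, hb, rfl⟩ := Finset.mem_image.1 ha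
    exact mem_leftOf.2 ⟨(hL _ _ (hM.1 (hp b hb))).2 (hS b hb), Or.inr ⟨b, hb, hp b hb⟩⟩

variable [Fintype V]

/-- The breadth-first layers of the alternating search from the free vertices of `L`. -/
def layer (L : Finset V) (H M : Finset (Sym2 V)) : ℕ → Finset V
  -- The empty start makes `leftOf L M (layer L H M 0)` exactly the set of free vertices of `L`.
  | 0 => ∅
  | i + 1 => {b | ∃ a ∈ leftOf L M (layer L H M i), s(a, b) ∈ H}

variable {L : Finset V} {H M : Finset (Sym2 V)}

lemma mem_layer_succ {i : ℕ} {b : V} :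
    b ∈ layer L H M (i + 1) ↔ ∃ a ∈ leftOf L M (layer L H M i), s(a, b) ∈ H := by
  simp [layer]

lemma layer_subset_succ (i : ℕ) : layer L H M i ⊆ layer L H M (i + 1) := by
  induction i with
  | zero => simp [layer]
  | succ i ih =>
    intro b hb
    obtain ⟨a, ha, hab⟩ := mem_layer_succ.1 hb
    refine mem_layer_succ.2 ⟨a, ?_, hab⟩
    rw [mem_leftOf] at ha ⊢
    exact ⟨ha.1, ha.2.imp_right fun ⟨b, hb, h⟩ => ⟨b, ih hb, h⟩⟩

lemma layer_mono : Monotone (layer L H M) :=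
  monotone_nat_of_le_succ layer_subset_succ

lemma notMem_of_mem_layer (hL : IsSplitBy L H) {i : ℕ} {b : V} (hb : b ∈ layer L H M i) :
    b ∉ L := by
  cases i with
  | zero => simp [layer] at hb
  | succ i =>
    obtain ⟨a, ha, hab⟩ := mem_layer_succ.1 hb
    exact (hL a b hab).1 (mem_leftOf.1 ha).1

/-- A vertex reached by the alternating search can be freed by shifting the matching along an
alternating path. -/
lemma exists_shift (hL : IsSplitBy L H) (hM : IsMatchingIn H M) (i : ℕ) :
    ∀ a ∈ leftOf L M (layer L H M i), ∃ M', IsMatchingIn H M' ∧ M'.card = M.card ∧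
      (∀ e ∈ M', a ∉ e) ∧
      (∀ b, b ∉ L → b ∉ layer L H M i → ∀ e, b ∈ e → (e ∈ M' ↔ e ∈ M)) ∧
      (symmDiff M' M).card ≤ 2 * i := by
  induction i with
  | zero =>
    intro a ha
    rw [mem_leftOf] at ha
    simp only [layer, Finset.notMem_empty, false_and, exists_false, or_false] at ha
    exact ⟨M, hM, rfl, ha.2, fun _ _ _ _ _ => Iff.rfl, by simp⟩
  | succ i ih =>
    intro a' ha'
    have key : ∀ M' : Finset (Sym2 V),
        (∀ b, b ∉ L → b ∉ layer L H M i → ∀ e, b ∈ e → (e ∈ M' ↔ e ∈ M)) →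
        ∀ b, b ∉ L → b ∉ layer L H M (i + 1) → ∀ e, b ∈ e → (e ∈ M' ↔ e ∈ M) :=
      fun M' h b hb hb' => h b hb fun h' => hb' (layer_subset_succ i h')
    by_cases hold : a' ∈ leftOf L M (layer L H M i)
    · obtain ⟨M', h1, h2, h3, h4, h5⟩ := ih a' hold
      exact ⟨M', h1, h2, h3, key M' h4, by omega⟩
    obtain ⟨ha'L, hfree | ⟨b, hb, hab'⟩⟩ := mem_leftOf.1 ha'
    · exact absurd (mem_leftOf.2 ⟨ha'L, Or.inl hfree⟩) hold
    have hbi : b ∉ layer L H M i := fun h =>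
      hold (mem_leftOf.2 ⟨ha'L, Or.inr ⟨b, h, hab'⟩⟩)
    obtain ⟨a, ha, hab⟩ := mem_layer_succ.1 hb
    obtain ⟨M', h1, h2, h3, h4, h5⟩ := ih a ha
    have haL := (mem_leftOf.1 ha).1
    have hbL := (hL a b hab).1 haL
    -- Since `b` is new in layer `i + 1`, the earlier shift left its edges alone. Replacing `s(a',
    -- b)` by `s(a, b)` now frees `a'` at the cost of two changes.
    have hmem : s(a', b) ∈ M' := (h4 b hbL hbi _ (by simp)).2 hab'
    have hne : a' ≠ a := by
      rintro rfl
      exact h3 _ hmem (by simp)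
    have ha'b : a' ≠ b := by
      rintro rfl
      exact hbL ha'L
    have herase : IsMatchingIn H (M'.erase s(a', b)) :=
      ⟨(Finset.erase_subset _ _).trans h1.1, fun e he f hf =>
        h1.2 e (Finset.mem_of_mem_erase he) f (Finset.mem_of_mem_erase hf)⟩
    obtain ⟨h6, h7⟩ := herase.insert_free hab (fun e he => h3 e (Finset.mem_of_mem_erase he))
      (fun e he hbe => (Finset.mem_erase.1 he).1
        (h1.2 e (Finset.mem_erase.1 he).2 _ hmem b hbe (by simp)))
    refine ⟨insert s(a, b) (M'.erase s(a', b)), h6, ?_, ?_, ?_, ?_⟩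
    · rw [h7, Finset.card_erase_add_one hmem, h2]
    · intro e he hae
      rcases Finset.mem_insert.1 he with rfl | he
      · rcases Sym2.mem_iff.1 hae with h | h
        · exact hne h
        · exact ha'b h
      · rw [Finset.mem_erase] at he
        exact he.1 (h1.2 e he.2 _ hmem a' hae (by simp))
    · intro b' hb'L hb' e hbe
      have hbb : b' ≠ b := by
        rintro rfl
        exact hb' hb
      have hx : ∀ c ∈ L, e ≠ s(c, b) := by
        rintro c hc rfl
        rcases Sym2.mem_iff.1 hbe with rfl | h
        · exact hb'L hc
        · exact hbb h
      rw [Finset.mem_insert, Finset.mem_erase, ← key M' h4 b' hb'L hb' e hbe]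
      simp [hx a haL, hx a' ha'L]
    · have h8 := card_symmDiff_insert_le s(a, b) (M'.erase s(a', b)) M
      have h9 := card_symmDiff_erase_le s(a', b) M' M
      omega

/-- A free vertex found by the alternating search yields a larger matching nearby. -/
lemma exists_augment (hL : IsSplitBy L H) (hM : IsMatchingIn H M) {k : ℕ} {b : V}
    (hb : b ∈ layer L H M (k + 1)) (hfree : ∀ e ∈ M, b ∉ e) :
    ∃ M', IsMatchingIn H M' ∧ M'.card = M.card + 1 ∧ (symmDiff M' M).card ≤ 2 * k + 1 := by
  induction k with
  | zero =>
    obtain ⟨a, ha, hab⟩ := mem_layer_succ.1 hb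
    have ha' := (mem_leftOf.1 ha).2
    simp only [layer, Finset.notMem_empty, false_and, exists_false, or_false] at ha'
    obtain ⟨h1, h2⟩ := hM.insert_free hab ha' hfree
    refine ⟨insert s(a, b) M, h1, h2, ?_⟩
    simpa using card_symmDiff_insert_le s(a, b) M M
  | succ k ih =>
    by_cases hbk : b ∈ layer L H M (k + 1)
    · obtain ⟨M', h1, h2, h3⟩ := ih hbk
      exact ⟨M', h1, h2, by omega⟩
    obtain ⟨a, ha, hab⟩ := mem_layer_succ.1 hb
    -- As `b` is outside layer `k + 1`, it remains free after the shift, and `s(a, b)` can be added.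
    obtain ⟨M', h1, h2, h3, h4, h5⟩ := exists_shift hL hM (k + 1) a ha
    have hbL := (hL a b hab).1 (mem_leftOf.1 ha).1
    have hfree' : ∀ e ∈ M', b ∉ e := fun e he hbe =>
      hfree e ((h4 b hbL hbk e hbe).1 he) hbe
    obtain ⟨h6, h7⟩ := h1.insert_free hab h3 hfree'
    refine ⟨insert s(a, b) M', h6, h7.trans (by rw [h2]), ?_⟩
    have := card_symmDiff_insert_le s(a, b) M' M
    omega

/-- Weak duality between fractional matchings and vertex covers. -/
lemma value_le_card_cover {x : Sym2 V → ℝ} (h0 : ∀ e, 0 ≤ x e) (hx : ∀ e ∉ H, x e = 0)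
    (hdeg : ∀ v : V, ∑ e : Sym2 V with v ∈ e, x e ≤ 1) {S : Finset V}
    (hS : ∀ e ∈ H, ∃ v ∈ S, v ∈ e) : value x ≤ S.card := by
  calc value x ≤ ∑ e : Sym2 V, ∑ v ∈ S, if v ∈ e then x e else 0 := by
        refine Finset.sum_le_sum fun e _ => ?_
        by_cases he : e ∈ H
        · obtain ⟨v, hv, hve⟩ := hS e he
          refine le_trans ?_ (Finset.single_le_sum (f := fun v => if v ∈ e then x e else 0)
            (fun v _ => ?_) hv)
          · simp [hve]
          · have := h0 e
            split_ifs <;> simp [this]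
        · simp [hx e he]
    _ = ∑ v ∈ S, ∑ e : Sym2 V with v ∈ e, x e := by
        rw [Finset.sum_comm]
        simp only [Finset.sum_filter]
    _ ≤ ∑ v ∈ S, 1 := Finset.sum_le_sum fun v _ => hdeg v
    _ = S.card := by simp

/-- A matching without short augmenting paths is nearly optimal, even among fractional
matchings. -/
theorem value_le_of_no_augment (hL : IsSplitBy L H) (hM : IsMatchingIn H M) {k : ℕ}
    (hno : ∀ M', IsMatchingIn H M' → M'.card = M.card + 1 → 2 * k + 1 < (symmDiff M' M).card)
    {x : Sym2 V → ℝ} (h0 : ∀ e, 0 ≤ x e) (hx : ∀ e ∉ H, x e = 0)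
    (hdeg : ∀ v : V, ∑ e : Sym2 V with v ∈ e, x e ≤ 1) :
    (k + 1) * value x ≤ (k + 2) * M.card := by
  have hcov : ∀ i ≤ k + 1, ∀ b ∈ layer L H M i, ∃ e ∈ M, b ∈ e := by
    intro i hi b hb
    by_contra! hfree
    obtain ⟨M', h1, h2, h3⟩ := exists_augment hL hM (layer_mono hi hb) hfree
    exact absurd h3 (not_le.2 (hno M' h1 h2))
  have hstep : ∀ i ≤ k, value x + (layer L H M i).card ≤
      M.card + (layer L H M (i + 1)).card := by
    intro i hi
    -- König-type cover: an edge whose left end is in `leftOf` of layer `i` has its right end in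
    -- layer `i + 1`. As layer `i` is fully matched, the cover has at most `|M| - |layer i| + |layer
    -- (i + 1)|` vertices.
    have h1 := value_le_card_cover h0 hx hdeg
      (S := (L \ leftOf L M (layer L H M i)) ∪ layer L H M (i + 1)) (by
        have main : ∀ a b, s(a, b) ∈ H → a ∈ L →
            ∃ v ∈ (L \ leftOf L M (layer L H M i)) ∪ layer L H M (i + 1), v ∈ s(a, b) := by
          intro a b hab ha
          by_cases h : a ∈ leftOf L M (layer L H M i)
          · exact ⟨b, Finset.mem_union_right _ (mem_layer_succ.2 ⟨a, h, hab⟩), by simp⟩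
          · exact ⟨a, Finset.mem_union_left _ (Finset.mem_sdiff.2 ⟨ha, h⟩), by simp⟩
        intro e he
        induction e with
        | h a b =>
          by_cases ha : a ∈ L
          · exact main a b he ha
          · rw [Sym2.eq_swap] at he ⊢
            exact main b a he ((hL b a he).2 ha))
    have h2 := card_leftOf_ge hL hM (fun b hb => notMem_of_mem_layer hL hb)
      (hcov i (by omega))
    have h3 : (L \ leftOf L M ∅).card ≤ M.card := by
      refine card_le_of_covered hL hM (Or.inl fun v hv => (Finset.mem_sdiff.1 hv).1) ?_
      intro v hv
      rw [Finset.mem_sdiff] at hv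
      by_contra! h
      exact hv.2 (mem_leftOf.2 ⟨hv.1, Or.inl h⟩)
    have h4 : ∀ S, leftOf L M S ⊆ L := fun S a ha => (mem_leftOf.1 ha).1
    have h5 := Finset.card_sdiff_add_card_eq_card (h4 ∅)
    have h6 := Finset.card_sdiff_add_card_eq_card (h4 (layer L H M i))
    have h7 := Finset.card_union_le (L \ leftOf L M (layer L H M i)) (layer L H M (i + 1))
    have h8 : ((L \ leftOf L M (layer L H M i)) ∪ layer L H M (i + 1)).card +
        (layer L H M i).card ≤ M.card + (layer L H M (i + 1)).card := by omega
    have h9 : ((((L \ leftOf L M (layer L H M i)) ∪ layer L H M (i + 1)).card : ℝ)) +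
        (layer L H M i).card ≤ M.card + (layer L H M (i + 1)).card := by exact_mod_cast h8
    linarith
  -- The layer sizes telescope; the last layer is matched, so it costs only one further `|M|`.
  have hsum : ∀ j ≤ k + 1, j * value x ≤ j * M.card + (layer L H M j).card := by
    intro j
    induction j with
    | zero => simp [layer]
    | succ j ih =>
      intro hj
      have := ih (by omega)
      have := hstep j (by omega)
      push_cast
      linarith
  have h1 := hsum (k + 1) le_rfl
  have h2 : ((layer L H M (k + 1)).card : ℝ) ≤ M.card := by
    exact_mod_cast card_le_of_covered hL hM
      (Or.inr fun b hb => notMem_of_mem_layer hL hb) (hcov (k + 1) le_rfl)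
  push_cast at h1
  linarith

end Augment

/-! ### Repairing a matching with amortized recourse. -/

section Rematch

variable {V : Type*} [Fintype V] [DecidableEq V]

/-- `M'` is a `(k + 1) / (k + 2)`-approximate matching in `H`, and changing the part of `M` inside
`H` into `M'` is paid for by the increase in size. -/
def IsRematch (k : ℕ) (H M M' : Finset (Sym2 V)) : Prop :=
  IsMatchingIn H M' ∧
    (symmDiff M' (M ∩ H)).card + (2 * k + 1) * (M ∩ H).card ≤ (2 * k + 1) * M'.card ∧
    ∀ x : Sym2 V → ℝ, (∀ e, 0 ≤ x e) → (∀ e ∉ H, x e = 0) →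
      (∀ v : V, ∑ e : Sym2 V with v ∈ e, x e ≤ 1) → (k + 1) * value x ≤ (k + 2) * M'.card

/-- Take a largest matching among those whose distance from `M ∩ H` is at most `2 * k + 1` per edge
gained. A further short augmentation would stay in this family, so none exists and
`value_le_of_no_augment` applies. -/
lemma exists_isRematch {L : Finset V} {H H' M : Finset (Sym2 V)} (hL : IsSplitBy L H)
    (hM : IsMatchingIn H' M) (k : ℕ) : ∃ M', IsRematch k H M M' := by
  classical
  obtain ⟨M', hM', hmax⟩ := Finset.exists_max_image
    (Finset.univ.filter fun M' => IsMatchingIn H M' ∧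
      (symmDiff M' (M ∩ H)).card + (2 * k + 1) * (M ∩ H).card ≤ (2 * k + 1) * M'.card)
    Finset.card ⟨M ∩ H, by simp [hM.inter H]⟩
  simp only [Finset.mem_filter, Finset.mem_univ, true_and] at hM' hmax
  refine ⟨M', hM'.1, hM'.2, fun x h0 hx hdeg =>
    value_le_of_no_augment hL hM'.1 (fun M'' h1 h2 => ?_) h0 hx hdeg⟩
  by_contra! h3
  have htri : (symmDiff M'' (M ∩ H)).card ≤
      (symmDiff M'' M').card + (symmDiff M' (M ∩ H)).card :=
    (Finset.card_le_card (symmDiff_triangle M'' M' (M ∩ H))).trans (Finset.card_union_le _ _)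
  have := hmax M'' ⟨h1, by rw [h2]; linarith [hM'.2]⟩
  omega

open Classical in
/-- The updated matching after the edge set has changed to `H`. -/
noncomputable def rematch (k : ℕ) (H M : Finset (Sym2 V)) : Finset (Sym2 V) :=
  -- The default is not used when `H` is bipartite and `M` is a matching.
  if h : ∃ M', IsRematch k H M M' then h.choose else ∅

lemma isRematch_rematch {L : Finset V} {H H' M : Finset (Sym2 V)} (hL : IsSplitBy L H)
    (hM : IsMatchingIn H' M) (k : ℕ) : IsRematch k H M (rematch k H M) := by
  rw [rematch, dif_pos (exists_isRematch hL hM k)]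
  exact (exists_isRematch hL hM k).choose_spec

/-- A matching edge that leaves the edge set costs one change and `2 * k + 1` of the size potential,
together `2 * k + 2`. -/
lemma IsRematch.card_symmDiff_le {k : ℕ} {H H' M M' : Finset (Sym2 V)} (hM : M ⊆ H)
    (h : IsRematch k H' M M') :
    (symmDiff M' M).card + (2 * k + 1) * M.card ≤
      (2 * k + 1) * M'.card + (2 * k + 2) * (H \ H').card := by
  have h1 : (symmDiff M' M).card ≤ (symmDiff M' (M ∩ H')).card + (M \ H').card := by
    refine (Finset.card_le_card ?_).trans (Finset.card_union_le _ _)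
    intro e
    simp only [Finset.mem_symmDiff, Finset.mem_union, Finset.mem_inter, Finset.mem_sdiff]
    tauto
  have h2 := Finset.card_inter_add_card_sdiff M H'
  have h3 : (M \ H').card ≤ (H \ H').card :=
    Finset.card_le_card (Finset.sdiff_subset_sdiff hM le_rfl)
  have h4 := h.2.1
  rw [← h2]
  nlinarith

/-- The total recourse of the matching is at most a multiple of the total change of the edge
sets. -/
theorem sum_card_symmDiff_rematch_le (k : ℕ) {H M : ℕ → Finset (Sym2 V)} (hH0 : H 0 = ∅)
    (hM0 : M 0 = ∅) {T : ℕ} (h : ∀ t < T, IsRematch k (H (t + 1)) (M t) (M (t + 1))) :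
    ∑ t ∈ Finset.range T, (symmDiff (M (t + 1)) (M t)).card ≤
      (2 * k + 2) * ∑ t ∈ Finset.range T, (symmDiff (H (t + 1)) (H t)).card := by
  have hsub : ∀ t ≤ T, M t ⊆ H t := by
    intro t ht
    cases t with
    | zero => rw [hM0]; exact Finset.empty_subset _
    | succ t => exact (h t ht).1.1
  -- Carrying `|H t|` along lets the final potential `(2 * k + 1) * |M T|` be charged to insertions,
  -- because `M T ⊆ H T`.
  have key : ∀ t ≤ T, ∑ s ∈ Finset.range t, (symmDiff (M (s + 1)) (M s)).card +
      (2 * k + 2) * (H t).card ≤ (2 * k + 1) * (M t).card +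
        (2 * k + 2) * ∑ s ∈ Finset.range t, (symmDiff (H (s + 1)) (H s)).card := by
    intro t
    induction t with
    | zero => simp [hH0]
    | succ t ih =>
      intro ht
      have h0 := ih (by omega)
      have h1 := (h t (by omega)).card_symmDiff_le (hsub t (by omega))
      have h2 : (symmDiff (H (t + 1)) (H t)).card =
          (H (t + 1) \ H t).card + (H t \ H (t + 1)).card := by
        rw [symmDiff_def, Finset.sup_eq_union, Finset.card_union_of_disjoint]
        exact disjoint_sdiff_sdiff
      have h3 := Finset.card_inter_add_card_sdiff (H t) (H (t + 1))
      have h4 := Finset.card_inter_add_card_sdiff (H (t + 1)) (H t)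
      rw [Finset.inter_comm] at h4
      rw [Finset.sum_range_succ, Finset.sum_range_succ, h2]
      have h5 : (2 * k + 2) * (H (t + 1)).card + (2 * k + 2) * (H t \ H (t + 1)).card =
          (2 * k + 2) * (H t).card + (2 * k + 2) * (H (t + 1) \ H t).card := by
        rw [← mul_add, ← mul_add]
        congr 1
        omega
      nlinarith
  have h1 := key T le_rfl
  have h2 : (2 * k + 1) * (M T).card ≤ (2 * k + 2) * (H T).card :=
    Nat.mul_le_mul (by omega) (Finset.card_le_card (hsub T le_rfl))
  omega

/-- In a bipartite graph some matching is at least as large as every fractional matching. -/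
theorem exists_matching_ge_opt {G : SimpleGraph V} (hG : G.IsBipartite) :
    ∃ M : Finset (Sym2 V), IsMatchingOf G M ∧ opt G ≤ M.card := by
  classical
  obtain ⟨L, hL⟩ := exists_isSplitBy hG
  obtain ⟨M, hM, hmax⟩ := Finset.exists_max_image
    (Finset.univ.filter fun M' => IsMatchingIn G.edgeFinset M') Finset.card
    ⟨∅, by simp [isMatchingIn_empty]⟩
  simp only [Finset.mem_filter, Finset.mem_univ, true_and] at hM hmax
  refine ⟨M, ⟨fun e he => SimpleGraph.mem_edgeFinset.1 (hM.1 he), hM.2⟩, ?_⟩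
  obtain ⟨x, hx, hxo⟩ := exists_value_eq_opt G
  rw [← hxo]
  by_contra! hlt
  -- A maximum matching admits no augmentation of any length, so the ratio `(k + 2) / (k + 1)` holds
  -- for all `k`; this `k` is large enough to contradict a positive gap.
  obtain ⟨k, hk⟩ := exists_nat_gt ((M.card : ℝ) / (value x - M.card))
  have h1 := value_le_of_no_augment (hL G.edgeFinset (by simp)) hM (k := k)
    (fun M' h1 h2 => by have := hmax M' h1; omega) hx.1
    (fun e he => hx.2.1 e (by simpa using he)) hx.2.2
  rw [div_lt_iff₀ (by linarith)] at hk
  nlinarith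

end Rematch

/-! ### Sampling with fixed uniform thresholds. -/

section Sampling

open MeasureTheory

variable {E : Type*} [Fintype E]

/-- The uniform distribution on the unit cube. -/
noncomputable def cubeMeasure (m : ℕ) : Measure (Fin m → ℝ) :=
  Measure.pi fun _ => volume.restrict (Set.Icc 0 1)

instance : IsProbabilityMeasure (volume.restrict (Set.Icc (0 : ℝ) 1)) := ⟨by simp⟩

instance (m : ℕ) : IsProbabilityMeasure (cubeMeasure m) := by
  unfold cubeMeasure
  infer_instance

/-- The coordinate of a seed that belongs to `e`. -/
noncomputable def coord (ω : Fin (Fintype.card E) → ℝ) (e : E) : ℝ := |ω (Fintype.equivFin E e)|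

/-- The random subset which contains `e` with probability `p e`. -/
noncomputable def sample (p : E → ℝ) (ω : Fin (Fintype.card E) → ℝ) : Finset E :=
  Finset.univ.filter fun e => coord ω e < p e

lemma mem_sample {p : E → ℝ} {ω : Fin (Fintype.card E) → ℝ} {e : E} :
    e ∈ sample p ω ↔ coord ω e < p e := by
  simp [sample]

/-- The absolute value in `coord` makes this true for every seed, not merely for those in the cube.
The matching guarantee is likewise required for every seed. -/
lemma sample_of_nonpos {p : E → ℝ} (hp : ∀ e, p e ≤ 0) (ω : Fin (Fintype.card E) → ℝ) :
    sample p ω = ∅ := by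
  refine Finset.eq_empty_of_forall_notMem fun e he => ?_
  exact absurd (mem_sample.1 he) (not_lt.2 ((hp e).trans (abs_nonneg _)))

/-- Independence of the thresholds; the absolute value is invisible on the cube. -/
lemma integral_prod_coord (f : E → ℝ → ℝ) :
    ∫ ω, ∏ e, f e (coord ω e) ∂cubeMeasure (Fintype.card E) =
      ∏ e, ∫ s in Set.Icc 0 1, f e s := by
  have h := integral_fintype_prod_eq_prod (𝕜 := ℝ)
    (μ := fun _ : Fin (Fintype.card E) => volume.restrict (Set.Icc (0 : ℝ) 1))
    (fun i s => f ((Fintype.equivFin E).symm i) |s|)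
  rw [← Equiv.prod_comp (Fintype.equivFin E)] at h
  simp only [Equiv.symm_apply_apply] at h
  have h2 : ∀ e, ∫ s in Set.Icc (0 : ℝ) 1, f e |s| = ∫ s in Set.Icc (0 : ℝ) 1, f e s :=
    fun e => setIntegral_congr_fun measurableSet_Icc fun s hs => by rw [abs_of_nonneg hs.1]
  simp only [h2] at h
  rw [← h]
  refine integral_congr_ae (Filter.Eventually.of_forall fun ω => ?_)
  simp only
  rw [← Equiv.prod_comp (Fintype.equivFin E)]
  simp [coord]

lemma integral_coord (e : E) (g : ℝ → ℝ) :
    ∫ ω, g (coord ω e) ∂cubeMeasure (Fintype.card E) = ∫ s in Set.Icc 0 1, g s := by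
  classical
  have h := integral_prod_coord (fun e' s => if e' = e then g s else 1)
  have h2 : ∀ e', ∫ s in Set.Icc (0 : ℝ) 1, (if e' = e then g s else 1) =
      if e' = e then ∫ s in Set.Icc (0 : ℝ) 1, g s else 1 := by
    intro e'
    split_ifs <;> simp
  simpa [h2] using h

lemma integral_ite_lt {p : ℝ} (h0 : 0 ≤ p) (h1 : p ≤ 1) (a b : ℝ) :
    ∫ s in Set.Icc (0 : ℝ) 1, (if s < p then a else b) = p * a + (1 - p) * b := by
  have h : ∀ s : ℝ, (if s < p then a else b) = (Set.Iio p).indicator (fun _ => a - b) s + b := by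
    intro s
    by_cases hs : s < p <;> simp [hs]
  have hi : Set.Iio p ∩ Set.Icc 0 1 = Set.Ico 0 p := by
    ext s
    simp only [Set.mem_inter_iff, Set.mem_Iio, Set.mem_Icc, Set.mem_Ico]
    constructor
    · rintro ⟨h1, h2, h3⟩
      exact ⟨h2, h1⟩
    · rintro ⟨h2, h3⟩
      exact ⟨h3, h2, by linarith⟩
  simp only [h]
  rw [integral_add ((integrable_const _).indicator measurableSet_Iio) (integrable_const _),
    integral_indicator measurableSet_Iio, Measure.restrict_restrict measurableSet_Iio, hi]
  simp [h0]
  ring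

lemma measurableSet_sample_eq (p : E → ℝ) (S : Finset E) :
    MeasurableSet {ω | sample p ω = S} := by
  have : {ω : Fin (Fintype.card E) → ℝ | sample p ω = S} =
      ⋂ e, {ω | |ω (Fintype.equivFin E e)| < p e ↔ e ∈ S} := by
    ext ω
    simp [Finset.ext_iff, mem_sample, coord]
  rw [this]
  refine MeasurableSet.iInter fun e => ?_
  have hm : Measurable fun ω : Fin (Fintype.card E) → ℝ => |ω (Fintype.equivFin E e)| :=
    (measurable_pi_apply _).abs
  by_cases he : e ∈ S
  · simpa [he] using measurableSet_lt hm measurable_const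
  · simpa [he] using measurableSet_le measurable_const hm

lemma integrable_of_measurableSet_eq {Ω α : Type*} [Finite α] [MeasurableSpace Ω]
    {μ : Measure Ω} [IsFiniteMeasure μ] {X : Ω → α} (hX : ∀ a, MeasurableSet {ω | X ω = a})
    (F : α → ℝ) : Integrable (fun ω => F (X ω)) μ := by
  let _ : MeasurableSpace α := ⊤
  have hm : Measurable X := measurable_to_countable' hX
  cases nonempty_fintype α
  refine Integrable.of_bound ((measurable_from_top (f := F)).comp hm).aestronglyMeasurable
    (∑ a, |F a|) (Filter.Eventually.of_forall fun ω => ?_)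
  exact Finset.single_le_sum (f := fun a => |F a|) (fun a _ => abs_nonneg _)
    (Finset.mem_univ (X ω))

lemma integrable_sample (p : E → ℝ) (F : Finset E → ℝ) :
    Integrable (fun ω => F (sample p ω)) (cubeMeasure (Fintype.card E)) :=
  integrable_of_measurableSet_eq (measurableSet_sample_eq p) F

lemma integral_mem_sample {p : E → ℝ} (h0 : ∀ e, 0 ≤ p e) (h1 : ∀ e, p e ≤ 1) (e : E) (w : ℝ) :
    ∫ ω, (if coord ω e < p e then w else 0) ∂cubeMeasure (Fintype.card E) = p e * w := by
  rw [integral_coord e fun s => if s < p e then w else 0, integral_ite_lt (h0 e) (h1 e)]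
  simp

/-- With common thresholds, the expected change of the sample is the change of the
probabilities. -/
lemma integral_card_symmDiff_sample [DecidableEq E] {p q : E → ℝ} (hp0 : ∀ e, 0 ≤ p e)
    (hp1 : ∀ e, p e ≤ 1) (hq0 : ∀ e, 0 ≤ q e) (hq1 : ∀ e, q e ≤ 1) :
    ∫ ω, ((symmDiff (sample p ω) (sample q ω)).card : ℝ) ∂cubeMeasure (Fintype.card E) =
      ∑ e, |p e - q e| := by
  -- An element changes status exactly when its threshold lies between the smaller and the larger
  -- probability.
  have h : ∀ ω, ((symmDiff (sample p ω) (sample q ω)).card : ℝ) =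
      ∑ e, ((if coord ω e < max (p e) (q e) then 1 else 0) -
        if coord ω e < min (p e) (q e) then 1 else 0) := by
    intro ω
    rw [Finset.card_eq_sum_ones, ← Finset.univ_inter (symmDiff _ _), ← Finset.sum_ite_mem]
    push_cast
    refine Finset.sum_congr rfl fun e _ => ?_
    simp only [Finset.mem_symmDiff, mem_sample, lt_max_iff, lt_min_iff]
    by_cases h1 : coord ω e < p e <;> by_cases h2 : coord ω e < q e <;> simp [h1, h2]
  have hint : ∀ r : E → ℝ, ∀ e, Integrable (fun ω => if coord ω e < r e then (1 : ℝ) else 0)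
      (cubeMeasure (Fintype.card E)) := by
    intro r e
    simpa only [mem_sample] using integrable_of_measurableSet_eq (measurableSet_sample_eq r)
      (fun S => if e ∈ S then (1 : ℝ) else 0)
  simp only [h]
  rw [integral_finsetSum _ fun e _ => by
    exact (hint (fun e => max (p e) (q e)) e).sub (hint (fun e => min (p e) (q e)) e)]
  refine Finset.sum_congr rfl fun e _ => ?_
  rw [integral_sub (hint (fun e => max (p e) (q e)) e) (hint (fun e => min (p e) (q e)) e),
    integral_mem_sample (p := fun e => max (p e) (q e)) (fun e => le_max_of_le_left (hp0 e))
      (fun e => max_le (hp1 e) (hq1 e)),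
    integral_mem_sample (p := fun e => min (p e) (q e)) (fun e => le_min (hp0 e) (hq0 e))
      (fun e => min_le_of_left_le (hp1 e)), mul_one, mul_one, max_sub_min_eq_abs']

/-- The sampling probability of an element of weight `a`. -/
noncomputable def sampleProb (γ a : ℝ) : ℝ := min 1 (γ * a)

/-- The weight of an element of weight `a` after it has been sampled. -/
noncomputable def sampleWeight (γ a : ℝ) : ℝ := max a (1 / γ)

variable {γ : ℝ}

lemma sampleProb_nonneg (hγ : 0 < γ) {a : ℝ} (ha : 0 ≤ a) : 0 ≤ sampleProb γ a :=
  le_min zero_le_one (by positivity)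

lemma sampleProb_le_one (a : ℝ) : sampleProb γ a ≤ 1 := min_le_left _ _

lemma sampleWeight_nonneg (hγ : 0 < γ) (a : ℝ) : 0 ≤ sampleWeight γ a :=
  le_max_of_le_right (by positivity)

/-- Hence the reweighted sample is unbiased. -/
lemma sampleProb_mul_sampleWeight (hγ : 0 < γ) (a : ℝ) :
    sampleProb γ a * sampleWeight γ a = a := by
  rcases le_total (γ * a) 1 with h | h
  · rw [sampleProb, sampleWeight, min_eq_right h,
      max_eq_right (by rwa [le_div_iff₀ hγ, mul_comm])]
    field_simp
  · rw [sampleProb, sampleWeight, min_eq_left h,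
      max_eq_left (by rwa [div_le_iff₀ hγ, mul_comm]), one_mul]

lemma abs_sampleProb_sub_le (hγ : 0 < γ) (a b : ℝ) :
    |sampleProb γ a - sampleProb γ b| ≤ γ * |a - b| := by
  refine (abs_min_sub_min_le_max 1 (γ * a) 1 (γ * b)).trans ?_
  rw [← mul_sub, abs_mul, abs_of_pos hγ, sub_self, abs_zero]
  exact max_le (by positivity) le_rfl

/-- The sampled weight is at most `a + 1 / γ`, and the excess costs a factor `exp s`. This serves
the single edge whose weight multiplies the exponential. -/
lemma exp_mul_sampleWeight_le (hγ : 0 < γ) {a s : ℝ} (ha : 0 ≤ a) (hs : 0 ≤ s) :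
    Real.exp (s * γ * sampleWeight γ a) ≤
      Real.exp s * Real.exp ((Real.exp s - 1) * γ * a) := by
  rw [← Real.exp_add, Real.exp_le_exp]
  have h1 : s ≤ Real.exp s - 1 := by linarith [Real.add_one_le_exp s]
  have h2 : s * (γ * a) ≤ (Real.exp s - 1) * (γ * a) :=
    mul_le_mul_of_nonneg_right h1 (by positivity)
  have h3 : 0 ≤ s * (γ * a) := by positivity
  rcases le_total a (1 / γ) with h | h
  · rw [sampleWeight, max_eq_right h]
    have : s * γ * (1 / γ) = s := by field_simp
    linarith
  · rw [sampleWeight, max_eq_left h]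
    linarith

/-- Poisson-type bound `1 + p * (exp s - 1) ≤ exp (p * (exp s - 1))` below saturation. At saturation
the element is deterministic and `s ≤ exp s - 1` suffices. -/
lemma sampleProb_mgf_le (hγ : 0 < γ) (a s : ℝ) :
    sampleProb γ a * Real.exp (s * γ * sampleWeight γ a) + (1 - sampleProb γ a) ≤
      Real.exp ((Real.exp s - 1) * γ * a) := by
  rcases le_total (γ * a) 1 with h | h
  · rw [sampleProb, sampleWeight, min_eq_right h,
      max_eq_right (by rwa [le_div_iff₀ hγ, mul_comm])]
    have : s * γ * (1 / γ) = s := by field_simp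
    rw [this]
    have := Real.add_one_le_exp ((Real.exp s - 1) * γ * a)
    linarith
  · rw [sampleProb, sampleWeight, min_eq_left h,
      max_eq_left (by rwa [div_le_iff₀ hγ, mul_comm])]
    have h1 : s ≤ Real.exp s - 1 := by linarith [Real.add_one_le_exp s]
    have h2 : s * (γ * a) ≤ (Real.exp s - 1) * (γ * a) :=
      mul_le_mul_of_nonneg_right h1 (by linarith)
    have : Real.exp (s * γ * a) ≤ Real.exp ((Real.exp s - 1) * γ * a) :=
      Real.exp_le_exp.2 (by linarith)
    linarith

/-- The sampled weight of `e` in the sample `S`. -/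
noncomputable def reweight {E : Type*} [DecidableEq E] (γ : ℝ) (x : E → ℝ) (S : Finset E) (e : E) : ℝ :=
  if e ∈ S then sampleWeight γ (x e) else 0

lemma reweight_nonneg {E : Type*} [DecidableEq E] (hγ : 0 < γ) (x : E → ℝ) (S : Finset E) (e : E) :
    0 ≤ reweight γ x S e := by
  rw [reweight]
  split_ifs
  · exact sampleWeight_nonneg hγ _
  · exact le_rfl

variable [DecidableEq E]

lemma integral_reweight (hγ : 0 < γ) {x : E → ℝ} (hx : ∀ e, 0 ≤ x e) (e : E) :
    ∫ ω, reweight γ x (sample (fun e => sampleProb γ (x e)) ω) e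
      ∂cubeMeasure (Fintype.card E) = x e := by
  simp only [reweight, mem_sample]
  rw [integral_mem_sample (p := fun e => sampleProb γ (x e))
    (fun e => sampleProb_nonneg hγ (hx e)) (fun e => sampleProb_le_one _),
    sampleProb_mul_sampleWeight hγ]

/-- A tilted exponential moment bound for sampled weights. -/
lemma integral_reweight_mul_exp_le (hγ : 0 < γ) {x : E → ℝ} (hx : ∀ e, 0 ≤ x e) {s : ℝ}
    (hs : 0 ≤ s) (F : Finset E) (hF : ∑ e ∈ F, x e ≤ 1) (e : E) :
    ∫ ω, reweight γ x (sample (fun e => sampleProb γ (x e)) ω) e *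
        Real.exp (s * γ * ∑ f ∈ F, reweight γ x (sample (fun e => sampleProb γ (x e)) ω) f)
      ∂cubeMeasure (Fintype.card E) ≤ x e * Real.exp (s + (Real.exp s - 1) * γ) := by
  -- `A f` and `B f` are the factors of `f` when it is in or out of the sample. `B e = 0` because an
  -- unsampled `e` has weight `0`.
  let A : E → ℝ := fun f => (if f = e then sampleWeight γ (x e) else 1) *
    if f ∈ F then Real.exp (s * γ * sampleWeight γ (x f)) else 1
  let B : E → ℝ := fun f => if f = e then 0 else 1
  have hprod : ∀ ω, reweight γ x (sample (fun e => sampleProb γ (x e)) ω) e *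
        Real.exp (s * γ * ∑ f ∈ F, reweight γ x (sample (fun e => sampleProb γ (x e)) ω) f) =
      ∏ f, if coord ω f < sampleProb γ (x f) then A f else B f := by
    intro ω
    have hsingle : reweight γ x (sample (fun e => sampleProb γ (x e)) ω) e = ∏ f, if f = e then
        reweight γ x (sample (fun e => sampleProb γ (x e)) ω) f else 1 := by simp
    rw [Finset.mul_sum, Real.exp_sum, ← Finset.univ_inter F, ← Finset.prod_ite_mem, hsingle,
      ← Finset.prod_mul_distrib]
    refine Finset.prod_congr rfl fun f _ => ?_
    simp only [reweight, mem_sample, A, B]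
    by_cases hfe : f = e
    · subst hfe
      by_cases h : coord ω f < sampleProb γ (x f) <;> simp [h]
    · by_cases h : coord ω f < sampleProb γ (x f) <;> simp [h, hfe]
  simp only [hprod]
  rw [integral_prod_coord fun f s => if s < sampleProb γ (x f) then A f else B f]
  have hbound : ∀ f, ∫ t in Set.Icc (0 : ℝ) 1, (if t < sampleProb γ (x f) then A f else B f) ≤
      (if f = e then x e * Real.exp s else 1) *
        if f ∈ F then Real.exp ((Real.exp s - 1) * γ * x f) else 1 := by
    intro f
    rw [integral_ite_lt (sampleProb_nonneg hγ (hx f)) (sampleProb_le_one _)]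
    simp only [A, B]
    by_cases hfe : f = e
    · subst hfe
      have h1 := exp_mul_sampleWeight_le hγ (hx f) hs
      have h2 := sampleProb_mul_sampleWeight hγ (x f)
      have h3 := Real.one_le_exp hs
      by_cases hfF : f ∈ F
      · simp only [if_true, hfF, mul_zero, add_zero]
        rw [← mul_assoc, h2, mul_assoc (x f)]
        exact mul_le_mul_of_nonneg_left h1 (hx f)
      · simp only [if_true, hfF, if_false, mul_zero, add_zero, mul_one]
        rw [h2]
        nlinarith [hx f]
    · by_cases hfF : f ∈ F
      · simp only [hfe, hfF, if_true, if_false, one_mul, mul_one]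
        exact sampleProb_mgf_le hγ (x f) s
      · simp [hfe, hfF]
  refine (Finset.prod_le_prod (fun f _ => ?_) fun f _ => hbound f).trans ?_
  · rw [integral_ite_lt (sampleProb_nonneg hγ (hx f)) (sampleProb_le_one _)]
    have h1 := sampleProb_nonneg hγ (hx f)
    have h2 : 0 ≤ 1 - sampleProb γ (x f) := by linarith [sampleProb_le_one (γ := γ) (x f)]
    have h3 := sampleWeight_nonneg hγ (x e)
    have hA : 0 ≤ A f := by
      simp only [A]
      split_ifs <;> positivity
    have hB : 0 ≤ B f := by
      simp only [B]
      split_ifs <;> positivity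
    positivity
  · rw [Finset.prod_mul_distrib, Finset.prod_ite_eq', Finset.prod_ite_mem, Finset.univ_inter,
      ← Real.exp_sum, ← Finset.mul_sum, Real.exp_add]
    simp only [Finset.mem_univ, if_true]
    rw [mul_assoc]
    have h1 : 0 ≤ Real.exp s - 1 := by linarith [Real.one_le_exp hs]
    have h2 : (Real.exp s - 1) * γ * ∑ i ∈ F, x i ≤ (Real.exp s - 1) * γ * 1 :=
      mul_le_mul_of_nonneg_left hF (by positivity)
    have h3 : Real.exp ((Real.exp s - 1) * γ * ∑ i ∈ F, x i) ≤
        Real.exp ((Real.exp s - 1) * γ) := Real.exp_le_exp.2 (by linarith)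
    have := hx e
    gcongr

end Sampling

/-! ### Value surviving in the sample. -/

section SampledMatching

open MeasureTheory

variable {V : Type*} [Fintype V] [DecidableEq V]

/-- A sampled graph contains a matching of nearly the value of the sampled fractional matching,
in expectation. -/
theorem value_le_integral_of_sample {γ η κ : ℝ} (hγ : 0 < γ) (hη0 : 0 < η) (hη1 : η ≤ 1)
    (hκ : 0 ≤ κ) {G : SimpleGraph V} {x : Sym2 V → ℝ} (hx : x ∈ fractionalMatchings G)
    {N : (Fin (Fintype.card (Sym2 V)) → ℝ) → ℝ} (hN0 : ∀ ω, 0 ≤ N ω)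
    (hNint : Integrable N (cubeMeasure (Fintype.card (Sym2 V))))
    (hN : ∀ ω, ∀ z : Sym2 V → ℝ, (∀ e, 0 ≤ z e) →
      (∀ e ∉ sample (fun e => sampleProb γ (x e)) ω, z e = 0) →
      (∀ v : V, ∑ e : Sym2 V with v ∈ e, z e ≤ 1) → value z ≤ κ * N ω) :
    value x * (1 - Fintype.card V * Real.exp (1 - γ * η ^ 2 / 4)) ≤
      κ * (1 + η) * ∫ ω, N ω ∂cubeMeasure (Fintype.card (Sym2 V)) := by
  set X := sample (fun e => sampleProb γ (x e)) with hX
  set s := η / 2 with hs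
  let Z : Finset (Sym2 V) → ℝ := fun S => ∑ e, reweight γ x S e
  let D : V → Finset (Sym2 V) → ℝ := fun v S => ∑ e : Sym2 V with v ∈ e, reweight γ x S e
  let P : V → Finset (Sym2 V) → ℝ := fun v S => Real.exp (s * γ * (D v S - (1 + η)))
  have hZ0 : ∀ S, 0 ≤ Z S := fun S => Finset.sum_nonneg fun e _ => reweight_nonneg hγ x S e
  -- If all degrees are at most `1 + η`, dividing by `1 + η` gives a fractional matching in the
  -- sample. Otherwise some `P v ≥ 1` and the left side is nonpositive. Multiplying by `Z` makes the
  -- expected loss proportional to `value x`, with no additive error.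
  have hpt : ∀ ω, Z (X ω) - ∑ v, Z (X ω) * P v (X ω) ≤ κ * (1 + η) * N ω := by
    intro ω
    have hP0 : ∀ v, 0 ≤ Z (X ω) * P v (X ω) := fun v =>
      mul_nonneg (hZ0 _) (Real.exp_pos _).le
    have hR : 0 ≤ κ * (1 + η) * N ω := mul_nonneg (by positivity) (hN0 ω)
    by_cases hgood : ∀ v, D v (X ω) ≤ 1 + η
    · have h1 := hN ω (fun e => reweight γ x (X ω) e / (1 + η))
        (fun e => div_nonneg (reweight_nonneg hγ x _ e) (by linarith))
        (fun e he => by simp [reweight, he])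
        (fun v => by
          rw [← Finset.sum_div, div_le_one (by linarith)]
          exact hgood v)
      rw [value, ← Finset.sum_div, div_le_iff₀ (by linarith)] at h1
      have h2 : 0 ≤ ∑ v, Z (X ω) * P v (X ω) := Finset.sum_nonneg fun v _ => hP0 v
      simp only [Z] at h2 ⊢
      linarith
    · push Not at hgood
      obtain ⟨v, hv⟩ := hgood
      have h1 : 1 ≤ P v (X ω) := Real.one_le_exp (by
        have : 0 ≤ D v (X ω) - (1 + η) := by linarith
        positivity)
      have h2 : Z (X ω) * P v (X ω) ≤ ∑ v, Z (X ω) * P v (X ω) :=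
        Finset.single_le_sum (f := fun v => Z (X ω) * P v (X ω)) (fun v _ => hP0 v)
          (Finset.mem_univ v)
      nlinarith [hZ0 (X ω)]
  have hint := integral_mono (μ := cubeMeasure (Fintype.card (Sym2 V)))
    (integrable_sample (fun e => sampleProb γ (x e)) fun S => Z S - ∑ v, Z S * P v S)
    (hNint.const_mul (κ * (1 + η))) hpt
  rw [integral_const_mul] at hint
  refine le_trans ?_ hint
  have hZP : ∀ v, ∫ ω, Z (X ω) * P v (X ω) ∂cubeMeasure (Fintype.card (Sym2 V)) ≤
      value x * Real.exp (1 - γ * η ^ 2 / 4) := by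
    intro v
    have h1 : ∀ ω, Z (X ω) * P v (X ω) = ∑ e, Real.exp (-(s * γ * (1 + η))) *
        (reweight γ x (X ω) e * Real.exp (s * γ * D v (X ω))) := by
      intro ω
      simp only [Z, P, Finset.sum_mul]
      refine Finset.sum_congr rfl fun e _ => ?_
      rw [mul_sub, sub_eq_add_neg, Real.exp_add]
      ring
    simp only [h1]
    rw [integral_finsetSum _ fun e _ => integrable_sample (fun e => sampleProb γ (x e))
      fun S => Real.exp (-(s * γ * (1 + η))) *
        (reweight γ x S e * Real.exp (s * γ * D v S)), value, Finset.sum_mul]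
    refine Finset.sum_le_sum fun e _ => ?_
    rw [integral_const_mul]
    have h2 := integral_reweight_mul_exp_le hγ hx.1 (s := s) (by positivity) _ (hx.2.2 v) e
    refine (mul_le_mul_of_nonneg_left h2 (Real.exp_pos _).le).trans ?_
    rw [mul_left_comm, ← Real.exp_add]
    refine mul_le_mul_of_nonneg_left (Real.exp_le_exp.2 ?_) (hx.1 e)
    -- With `s = η / 2` the exponent is at most `s + γ * s ^ 2 - s * γ * η`, hence at most `1 - γ *
    -- η ^ 2 / 4`.
    have h3 := (abs_le.1 (Real.abs_exp_sub_one_sub_id_le (x := s)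
      (by rw [abs_of_nonneg (by positivity)]; linarith))).2
    have h4 : γ * (Real.exp s - 1 - s) ≤ γ * s ^ 2 := mul_le_mul_of_nonneg_left h3 hγ.le
    have h5 : s ≤ 1 := by linarith
    have h6 : γ * s ^ 2 = γ * η ^ 2 / 4 := by rw [hs]; ring
    have h7 : s * γ * η = γ * η ^ 2 / 2 := by rw [hs]; ring
    nlinarith
  have hsplit : ∫ ω, (Z (X ω) - ∑ v, Z (X ω) * P v (X ω))
        ∂cubeMeasure (Fintype.card (Sym2 V)) =
      value x - ∑ v, ∫ ω, Z (X ω) * P v (X ω) ∂cubeMeasure (Fintype.card (Sym2 V)) := by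
    rw [integral_sub (integrable_sample (fun e => sampleProb γ (x e)) Z)
      (integrable_sample (fun e => sampleProb γ (x e)) fun S => ∑ v, Z S * P v S),
      integral_finsetSum _ fun v _ => integrable_sample (fun e => sampleProb γ (x e))
        fun S => Z S * P v S]
    congr 1
    simp only [Z]
    rw [integral_finsetSum _ fun e _ => integrable_sample (fun e => sampleProb γ (x e))
      fun S => reweight γ x S e]
    exact Finset.sum_congr rfl fun e _ => integral_reweight hγ hx.1 e
  have hsum : ∑ v, ∫ ω, Z (X ω) * P v (X ω) ∂cubeMeasure (Fintype.card (Sym2 V)) ≤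
      Fintype.card V * (value x * Real.exp (1 - γ * η ^ 2 / 4)) := by
    refine (Finset.sum_le_sum fun v _ => hZP v).trans ?_
    simp [Finset.card_univ]
  change _ ≤ ∫ ω, (Z (X ω) - ∑ v, Z (X ω) * P v (X ω)) ∂cubeMeasure (Fintype.card (Sym2 V))
  rw [hsplit]
  linarith

end SampledMatching

/-! ### The online algorithm and its guarantees. -/

section SamplingAlgorithm

open MeasureTheory

variable {V : Type*} [Fintype V] [DecidableEq V]

/-- The fractional matching after the updates in the list, the latest of which comes first. -/
noncomputable def chaseRun (δ β η : ℝ) (G₀ : SimpleGraph V) :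
    List (EdgeUpdate V) → Sym2 V → ℝ
  | [] => 0
  | u :: τ => chaseStep δ β η (chaseRun δ β η G₀ τ) (currentGraph G₀ (u :: τ).reverse)

/-- The random sparse edge set drawn from a fractional matching. -/
noncomputable def sparsify (γ : ℝ) (x : Sym2 V → ℝ)
    (ω : Fin (Fintype.card (Sym2 V)) → ℝ) : Finset (Sym2 V) :=
  sample (fun e => sampleProb γ (x e)) ω

/-- The matching after the updates in the list, the latest of which comes first. -/
noncomputable def roundRun (δ β η γ : ℝ) (k : ℕ) (ω : Fin (Fintype.card (Sym2 V)) → ℝ)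
    (G₀ : SimpleGraph V) : List (EdgeUpdate V) → Finset (Sym2 V)
  | [] => ∅
  | u :: τ => rematch k (sparsify γ (chaseRun δ β η G₀ (u :: τ)) ω) (roundRun δ β η γ k ω G₀ τ)

lemma measurableSet_roundRun (δ β η γ : ℝ) (k : ℕ) (G₀ : SimpleGraph V)
    (τ : List (EdgeUpdate V)) (M : Finset (Sym2 V)) :
    MeasurableSet {ω | roundRun δ β η γ k ω G₀ τ = M} := by
  induction τ generalizing M with
  | nil => simp [roundRun]
  | cons u τ ih =>
    have : {ω | roundRun δ β η γ k ω G₀ (u :: τ) = M} =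
        ⋃ S : Finset (Sym2 V), ⋃ A : Finset (Sym2 V), ⋃ _ : rematch k S A = M,
          {ω | sparsify γ (chaseRun δ β η G₀ (u :: τ)) ω = S} ∩
            {ω | roundRun δ β η γ k ω G₀ τ = A} := by
      ext ω
      simp [roundRun]
    rw [this]
    exact MeasurableSet.iUnion fun S => MeasurableSet.iUnion fun A => MeasurableSet.iUnion
      fun _ => (measurableSet_sample_eq _ S).inter (ih A)

/-- Chase fractionally, sample with fixed thresholds, and repair the matching in the sample. -/
noncomputable def samplingAlgorithm (V : Type*) [Fintype V] [DecidableEq V] (δ β η γ : ℝ)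
    (k : ℕ) : RandomizedAlgorithm V where
  -- Seeds are indexed by `Fin` since `Ω` must live in `Type`, while `V` may lie in any universe.
  Ω := Fin (Fintype.card (Sym2 V)) → ℝ
  μ := cubeMeasure (Fintype.card (Sym2 V))
  output ω G₀ σ := roundRun δ β η γ k ω G₀ σ.reverse
  measurableSet_output G₀ σ M := measurableSet_roundRun δ β η γ k G₀ σ.reverse M

lemma take_succ_reverse {α : Type*} {l : List α} {t : ℕ} (ht : t < l.length) :
    (l.take (t + 1)).reverse = l[t] :: (l.take t).reverse := by
  rw [List.take_add_one, List.getElem?_eq_getElem ht]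
  simp

section Run

variable {δ β η γ : ℝ} {k : ℕ} {G₀ : SimpleGraph V} {σ : List (EdgeUpdate V)}

lemma chaseRun_succ {t : ℕ} (ht : t < σ.length) :
    chaseRun δ β η G₀ (σ.take (t + 1)).reverse =
      chaseStep δ β η (chaseRun δ β η G₀ (σ.take t).reverse) (graphAt G₀ σ (t + 1)) := by
  have h : graphAt G₀ σ (t + 1) = currentGraph G₀ (σ.take (t + 1)).reverse.reverse := by
    rw [List.reverse_reverse, graphAt]
  rw [h, take_succ_reverse ht, chaseRun]

lemma chaseRun_mem (hδ : 0 < δ) (hβ0 : 0 ≤ β) (hβ : β ≤ 1) (hη : 0 ≤ η) :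
    ∀ t ≤ σ.length, chaseRun δ β η G₀ (σ.take t).reverse ∈ fractionalMatchings (graphAt G₀ σ t) ∧
      (1 ≤ t → (1 - η) * β * opt (graphAt G₀ σ t) ≤
        value (chaseRun δ β η G₀ (σ.take t).reverse)) := by
  intro t
  induction t with
  | zero =>
    intro _
    refine ⟨?_, by omega⟩
    simpa [chaseRun] using zero_mem_fractionalMatchings
  | succ t ih =>
    intro ht
    rw [chaseRun_succ (by omega)]
    have := (chaseStep_spec hδ hβ0 hβ hη (ih (by omega)).1.1 (graphAt G₀ σ (t + 1))).1
    exact ⟨this.1, fun _ => this.2⟩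

lemma sparsify_subset {G : SimpleGraph V} {x : Sym2 V → ℝ} (hx : x ∈ fractionalMatchings G)
    (ω : Fin (Fintype.card (Sym2 V)) → ℝ) : ∀ e ∈ sparsify γ x ω, e ∈ G.edgeSet := by
  intro e he
  by_contra h
  have := mem_sample.1 he
  rw [hx.2.1 e h, sampleProb, mul_zero, min_eq_right zero_le_one] at this
  exact absurd this (not_lt.2 (abs_nonneg _))

lemma isRematch_roundRun (hδ : 0 < δ) (hβ0 : 0 ≤ β) (hβ : β ≤ 1) (hη : 0 ≤ η)
    (hσ : ∀ t ≤ σ.length, (graphAt G₀ σ t).IsBipartite)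
    (ω : Fin (Fintype.card (Sym2 V)) → ℝ) : ∀ t < σ.length,
      IsRematch k (sparsify γ (chaseRun δ β η G₀ (σ.take (t + 1)).reverse) ω)
        (roundRun δ β η γ k ω G₀ (σ.take t).reverse)
        (roundRun δ β η γ k ω G₀ (σ.take (t + 1)).reverse) := by
  have step : ∀ t < σ.length, (∃ H, IsMatchingIn H (roundRun δ β η γ k ω G₀ (σ.take t).reverse)) →
      IsRematch k (sparsify γ (chaseRun δ β η G₀ (σ.take (t + 1)).reverse) ω)
        (roundRun δ β η γ k ω G₀ (σ.take t).reverse)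
        (roundRun δ β η γ k ω G₀ (σ.take (t + 1)).reverse) := by
    rintro t ht ⟨H, hH⟩
    obtain ⟨L, hL⟩ := exists_isSplitBy (hσ (t + 1) ht)
    have := isRematch_rematch (hL _ (sparsify_subset (γ := γ)
      (chaseRun_mem hδ hβ0 hβ hη (t + 1) ht).1 ω)) hH k
    rw [take_succ_reverse ht] at this ⊢
    exact this
  -- `rematch` behaves well only on a previous output that is a matching somewhere; this is supplied
  -- by induction on time.
  intro t ht
  refine step t ht ?_
  induction t with
  | zero => exact ⟨∅, by simpa [roundRun] using isMatchingIn_empty ∅⟩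
  | succ t ih => exact ⟨_, (step t (by omega) (ih (by omega))).1⟩

lemma samplingAlgorithm_isMatchingOf (hδ : 0 < δ) (hβ0 : 0 ≤ β) (hβ : β ≤ 1) (hη : 0 ≤ η)
    (hσ : ∀ t ≤ σ.length, (graphAt G₀ σ t).IsBipartite)
    (ω : (samplingAlgorithm V δ β η γ k).Ω) :
    ∀ t ≤ σ.length,
      IsMatchingOf (graphAt G₀ σ t) ((samplingAlgorithm V δ β η γ k).outputAt ω G₀ σ t) := by
  intro t ht
  cases t with
  | zero => simp [IsMatchingOf, RandomizedAlgorithm.outputAt, samplingAlgorithm, roundRun]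
  | succ t =>
    have h := (isRematch_roundRun (γ := γ) (k := k) hδ hβ0 hβ hη hσ ω t ht).1
    exact ⟨fun e he => sparsify_subset (chaseRun_mem hδ hβ0 hβ hη (t + 1) ht).1 ω e (h.1 he), h.2⟩

lemma samplingAlgorithm_expectedSize (hδ : 0 < δ) (hβ0 : 0 ≤ β) (hβ : β ≤ 1) (hη0 : 0 < η)
    (hη1 : η ≤ 1) (hγ : 0 < γ) (hσ : ∀ t ≤ σ.length, (graphAt G₀ σ t).IsBipartite)
    (hq : Fintype.card V * Real.exp (1 - γ * η ^ 2 / 4) ≤ 1) {t : ℕ} (ht1 : 1 ≤ t)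
    (ht : t ≤ σ.length) :
    (1 - η) * β * opt (graphAt G₀ σ t) *
        (1 - Fintype.card V * Real.exp (1 - γ * η ^ 2 / 4)) ≤
      (k + 2) / (k + 1) * (1 + η) * (samplingAlgorithm V δ β η γ k).expectedSize G₀ σ t := by
  obtain ⟨hx, hval⟩ := chaseRun_mem (G₀ := G₀) (σ := σ) hδ hβ0 hβ hη0.le t ht
  have hk : (0 : ℝ) < k + 1 := by positivity
  refine (mul_le_mul_of_nonneg_right (hval ht1) (by linarith)).trans ?_
  refine value_le_integral_of_sample hγ hη0 hη1 (by positivity) hx (fun ω => by positivity) ?_ ?_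
  · exact integrable_of_measurableSet_eq
      (measurableSet_roundRun δ β η γ k G₀ (σ.take t).reverse) fun M => (M.card : ℝ)
  · intro ω z h0 hz hdeg
    obtain ⟨t, rfl⟩ : ∃ s, t = s + 1 := ⟨t - 1, by omega⟩
    have := (isRematch_roundRun (γ := γ) (k := k) hδ hβ0 hβ hη0.le hσ ω t ht).2.2 z h0 hz hdeg
    rw [div_mul_eq_mul_div, le_div_iff₀ hk, mul_comm]
    exact this

lemma samplingAlgorithm_expectedRecourse_le_movement (hδ : 0 < δ) (hβ0 : 0 ≤ β) (hβ : β ≤ 1)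
    (hη : 0 ≤ η) (hγ : 0 < γ) (hσ : ∀ t ≤ σ.length, (graphAt G₀ σ t).IsBipartite) :
    (samplingAlgorithm V δ β η γ k).expectedRecourse G₀ σ ≤
      (2 * k + 2) * (γ * movement (fun t => chaseRun δ β η G₀ (σ.take t).reverse) σ.length) := by
  set x : ℕ → Sym2 V → ℝ := fun t => chaseRun δ β η G₀ (σ.take t).reverse with hx
  have hpt : ∀ ω, ∑ t ∈ Finset.range σ.length,
      ((symmDiff (roundRun δ β η γ k ω G₀ (σ.take (t + 1)).reverse)
        (roundRun δ β η γ k ω G₀ (σ.take t).reverse)).card : ℝ) ≤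
      (2 * k + 2) * ∑ t ∈ Finset.range σ.length,
        ((symmDiff (sparsify γ (x (t + 1)) ω) (sparsify γ (x t) ω)).card : ℝ) := by
    intro ω
    have := sum_card_symmDiff_rematch_le k
      (H := fun t => sparsify γ (x t) ω)
      (M := fun t => roundRun δ β η γ k ω G₀ (σ.take t).reverse)
      (sample_of_nonpos (fun e => by simp [hx, chaseRun, sampleProb]) ω) (by simp [roundRun])
      (isRematch_roundRun hδ hβ0 hβ hη hσ ω)
    exact_mod_cast this
  have hpair : ∀ (τ τ' : List (EdgeUpdate V)), Integrable (fun ω =>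
      ((symmDiff (roundRun δ β η γ k ω G₀ τ) (roundRun δ β η γ k ω G₀ τ')).card : ℝ))
      (cubeMeasure (Fintype.card (Sym2 V))) := by
    intro τ τ'
    refine integrable_of_measurableSet_eq
      (X := fun ω => (roundRun δ β η γ k ω G₀ τ, roundRun δ β η γ k ω G₀ τ')) (fun a => ?_)
      (fun a => ((symmDiff a.1 a.2).card : ℝ))
    have : {ω | (roundRun δ β η γ k ω G₀ τ, roundRun δ β η γ k ω G₀ τ') = a} =
        {ω | roundRun δ β η γ k ω G₀ τ = a.1} ∩ {ω | roundRun δ β η γ k ω G₀ τ' = a.2} := by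
      ext ω
      simp [Prod.ext_iff]
    rw [this]
    exact (measurableSet_roundRun _ _ _ _ _ _ _ _).inter (measurableSet_roundRun _ _ _ _ _ _ _ _)
  have hpair' : ∀ t, Integrable (fun ω =>
      ((symmDiff (sparsify γ (x (t + 1)) ω) (sparsify γ (x t) ω)).card : ℝ))
      (cubeMeasure (Fintype.card (Sym2 V))) := by
    intro t
    refine integrable_of_measurableSet_eq
      (X := fun ω => (sparsify γ (x (t + 1)) ω, sparsify γ (x t) ω)) (fun a => ?_)
      (fun a => ((symmDiff a.1 a.2).card : ℝ))
    have : {ω | (sparsify γ (x (t + 1)) ω, sparsify γ (x t) ω) = a} =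
        {ω | sparsify γ (x (t + 1)) ω = a.1} ∩ {ω | sparsify γ (x t) ω = a.2} := by
      ext ω
      simp [Prod.ext_iff]
    rw [this]
    exact (measurableSet_sample_eq _ _).inter (measurableSet_sample_eq _ _)
  refine (integral_mono (μ := cubeMeasure (Fintype.card (Sym2 V)))
    (integrable_finsetSum _ fun t _ => hpair _ _)
    ((integrable_finsetSum _ fun t _ => hpair' t).const_mul _) hpt).trans ?_
  rw [integral_const_mul, integral_finsetSum _ fun t _ => hpair' t]
  refine mul_le_mul_of_nonneg_left ?_ (by positivity)
  rw [movement, Finset.mul_sum]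
  refine Finset.sum_le_sum fun t ht => ?_
  have ht := Finset.mem_range.1 ht
  have h1 := (chaseRun_mem (G₀ := G₀) (σ := σ) hδ hβ0 hβ hη (t + 1) ht).1.1
  have h0 := (chaseRun_mem (G₀ := G₀) (σ := σ) hδ hβ0 hβ hη t ht.le).1.1
  simp only [sparsify]
  rw [integral_card_symmDiff_sample (fun e => sampleProb_nonneg hγ (h1 e))
    (fun e => sampleProb_le_one _) (fun e => sampleProb_nonneg hγ (h0 e))
    (fun e => sampleProb_le_one _), Finset.mul_sum]
  exact Finset.sum_le_sum fun e _ => abs_sampleProb_sub_le hγ _ _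

theorem samplingAlgorithm_expectedRecourse_le (hδ : 0 < δ) (hβ0 : 0 ≤ β) (hβ : β ≤ 1)
    (hη0 : 0 < η) (hη : η < 1) (hγ : 0 < γ)
    (hσ : ∀ t ≤ σ.length, (graphAt G₀ σ t).IsBipartite) :
    (samplingAlgorithm V δ β η γ k).expectedRecourse G₀ σ ≤
      (2 * k + 2) * (γ * (2 * (2 / η * Real.log (1 + 1 / δ) * optRecourse β G₀ σ +
        σ.length * (Fintype.card (Sym2 V) * δ)))) := by
  refine (samplingAlgorithm_expectedRecourse_le_movement hδ hβ0 hβ hη0.le hγ hσ).trans ?_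
  have := movement_chase_le hδ hβ0 hβ hη0 hη G₀ σ
    (x := fun t => chaseRun δ β η G₀ (σ.take t).reverse) (by simp [chaseRun])
    (fun t ht => chaseRun_succ ht)
  gcongr

end Run

end SamplingAlgorithm

/-! ### The trivial algorithm, for very small `ε`. -/

section RecomputingAlgorithm

open MeasureTheory

lemma IsMatchingOf.card_le {V : Type*} [Fintype V] {G : SimpleGraph V} {M : Finset (Sym2 V)}
    (hM : IsMatchingOf G M) : M.card ≤ (Fintype.card V).choose 2 := by
  classical
  exact (Finset.card_le_card fun e he => SimpleGraph.mem_edgeFinset.2 (hM.1 e he)).trans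
    G.card_edgeFinset_le_card_choose_two

variable {V : Type*} [Fintype V] [DecidableEq V]

open Classical in
/-- A matching at least as large as every fractional matching, if there is one. -/
noncomputable def maxMatching (G : SimpleGraph V) : Finset (Sym2 V) :=
  if h : ∃ M, IsMatchingOf G M ∧ opt G ≤ M.card then h.choose else ∅

lemma maxMatching_spec {G : SimpleGraph V} (hG : G.IsBipartite) :
    IsMatchingOf G (maxMatching G) ∧ opt G ≤ (maxMatching G).card := by
  rw [maxMatching, dif_pos (exists_matching_ge_opt hG)]
  exact (exists_matching_ge_opt hG).choose_spec

/-- Recompute a maximum matching after each update. -/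
noncomputable def recomputingAlgorithm (V : Type*) [Fintype V] [DecidableEq V] :
    RandomizedAlgorithm V where
  Ω := Unit
  μ := Measure.dirac ()
  -- The empty output before any update is forced by `M^0 = ∅`.
  output _ G₀ σ := if σ.isEmpty then ∅ else maxMatching (currentGraph G₀ σ)
  measurableSet_output _ _ _ := MeasurableSet.of_discrete

variable {G₀ : SimpleGraph V} {σ : List (EdgeUpdate V)}

lemma recomputingAlgorithm_outputAt {t : ℕ} (ht1 : 1 ≤ t) (ht : t ≤ σ.length) (ω : Unit) :
    (recomputingAlgorithm V).outputAt ω G₀ σ t = maxMatching (graphAt G₀ σ t) := by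
  have : σ.take t ≠ [] := by
    rw [Ne, List.take_eq_nil_iff]
    rintro (h | rfl)
    · omega
    · simp at ht
      omega
  simp [RandomizedAlgorithm.outputAt, recomputingAlgorithm, graphAt, this]

lemma recomputingAlgorithm_isMatchingOf (hσ : ∀ t ≤ σ.length, (graphAt G₀ σ t).IsBipartite)
    (ω : Unit) : ∀ t ≤ σ.length,
      IsMatchingOf (graphAt G₀ σ t) ((recomputingAlgorithm V).outputAt ω G₀ σ t) := by
  intro t ht
  cases t with
  | zero => simp [IsMatchingOf, RandomizedAlgorithm.outputAt, recomputingAlgorithm]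
  | succ t =>
    rw [recomputingAlgorithm_outputAt (by omega) ht]
    exact (maxMatching_spec (hσ _ ht)).1

lemma recomputingAlgorithm_expectedSize (hσ : ∀ t ≤ σ.length, (graphAt G₀ σ t).IsBipartite)
    {t : ℕ} (ht1 : 1 ≤ t) (ht : t ≤ σ.length) :
    opt (graphAt G₀ σ t) ≤ (recomputingAlgorithm V).expectedSize G₀ σ t := by
  have h : ∀ ω : Unit, opt (graphAt G₀ σ t) ≤
      (((recomputingAlgorithm V).outputAt ω G₀ σ t).card : ℝ) := by
    intro ω
    rw [recomputingAlgorithm_outputAt ht1 ht]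
    exact (maxMatching_spec (hσ t ht)).2
  refine (h ()).trans (le_of_eq ?_)
  exact (integral_dirac (fun ω : Unit =>
    (((recomputingAlgorithm V).outputAt ω G₀ σ t).card : ℝ)) ()).symm

/-- Each step changes at most two matchings' worth of edges, that is, twice `n.choose 2`. -/
lemma recomputingAlgorithm_expectedRecourse
    (hσ : ∀ t ≤ σ.length, (graphAt G₀ σ t).IsBipartite) :
    (recomputingAlgorithm V).expectedRecourse G₀ σ ≤
      σ.length * ((Fintype.card V : ℝ) * (Fintype.card V - 1)) := by
  have h := integral_dirac (fun ω : Unit => ∑ t ∈ Finset.range σ.length,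
    ((symmDiff ((recomputingAlgorithm V).outputAt ω G₀ σ (t + 1))
      ((recomputingAlgorithm V).outputAt ω G₀ σ t)).card : ℝ)) ()
  refine (le_of_eq h).trans ?_
  have hc : ∀ t ≤ σ.length, (((recomputingAlgorithm V).outputAt () G₀ σ t).card : ℝ) ≤
      (Fintype.card V : ℝ) * (Fintype.card V - 1) / 2 := by
    intro t ht
    rw [← Nat.cast_choose_two]
    exact_mod_cast (recomputingAlgorithm_isMatchingOf hσ () t ht).card_le
  calc _ ≤ ∑ t ∈ Finset.range σ.length, (Fintype.card V : ℝ) * (Fintype.card V - 1) := by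
        refine Finset.sum_le_sum fun t ht => ?_
        have ht := Finset.mem_range.1 ht
        have h1 := hc t ht.le
        have h2 := hc (t + 1) ht
        have h3 : ((symmDiff ((recomputingAlgorithm V).outputAt () G₀ σ (t + 1))
            ((recomputingAlgorithm V).outputAt () G₀ σ t)).card : ℝ) ≤
            ((recomputingAlgorithm V).outputAt () G₀ σ (t + 1)).card +
              ((recomputingAlgorithm V).outputAt () G₀ σ t).card := by
          exact_mod_cast (Finset.card_le_card symmDiff_le_sup).trans (Finset.card_union_le _ _)
        linarith
    _ = _ := by simp

end RecomputingAlgorithm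

/-! ### Numerical choice of the parameters. -/

section Parameters

/-- Four losses of order `η` combine: `(1 - η) ^ 2 / (1 + η) ^ 2 ≥ 1 - 8 * η`, which explains `η = ε
/ 8`. -/
lemma size_parameters {η B S q κ : ℝ} (hη0 : 0 < η) (hη1 : η ≤ 1 / 8) (hB : 0 ≤ B)
    (hS : 0 ≤ S) (hq : q ≤ η) (hκ : κ ≤ 1 + η)
    (h : (1 - η) * B * (1 - q) ≤ κ * (1 + η) * S) : (1 - 8 * η) * B ≤ S := by
  have h1 : (1 - η) * B * (1 - η) ≤ (1 + η) * (1 + η) * S := by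
    refine le_trans ?_ (h.trans ?_)
    · exact mul_le_mul_of_nonneg_left (by linarith) (mul_nonneg (by linarith) hB)
    · gcongr
  have h2 : (1 - 8 * η) * ((1 + η) * (1 + η)) ≤ (1 - η) * (1 - η) := by nlinarith [pow_pos hη0 3]
  have h3 := mul_le_mul_of_nonneg_right h2 hB
  refine le_of_mul_le_mul_left (a := (1 + η) * (1 + η)) ?_ (by positivity)
  linarith

/-- This `γ` makes the exponential equal to `exp 1 / n ^ (c + 9)`. Of the power, `n ^ (c + 2)`
absorbs `1 / ε` and the rest absorbs the union bound and constants. -/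
lemma failure_probability_le {n ε η γ : ℝ} {c : ℕ} (hn : 2 ≤ n) (hε : 1 ≤ ε * n ^ (c + 2))
    (hη : η = ε / 8) (hη0 : 0 < η) (hγ : γ = 4 * (c + 9) * Real.log n / η ^ 2) :
    n * Real.exp (1 - γ * η ^ 2 / 4) ≤ η := by
  have hn0 : 0 < n := by linarith
  have h1 : γ * η ^ 2 / 4 = ((c + 9 : ℕ) : ℝ) * Real.log n := by
    rw [hγ]
    push_cast
    field_simp
  rw [h1, Real.exp_sub, Real.exp_nat_mul, Real.exp_log hn0, mul_div_assoc', div_le_iff₀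
    (by positivity), hη]
  have h2 : Real.exp 1 ≤ 3 := by linarith [Real.exp_one_lt_d9]
  have h3 : (2 : ℝ) ^ 6 ≤ n ^ 6 := by gcongr
  have h4 : ε / 8 * n ^ (c + 9) = ε * n ^ (c + 2) * (n ^ 6 * n) / 8 := by ring
  rw [h4]
  have h5 : n ^ 6 * n ≤ ε * n ^ (c + 2) * (n ^ 6 * n) := le_mul_of_one_le_left (by positivity) hε
  nlinarith

lemma log_one_add_le {n ε : ℝ} {d : ℕ} (hn : 2 ≤ n) (hε0 : 0 < ε) (hε1 : ε ≤ 1) :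
    Real.log (1 + 1 / (1 / n ^ d)) ≤ (d + 1) * Real.log (n / ε) := by
  have hn0 : 0 < n := by linarith
  have h1 : 1 + 1 / (1 / n ^ d) ≤ n ^ (d + 1) := by
    rw [one_div_one_div, pow_succ]
    have : 1 ≤ n ^ d := one_le_pow₀ (by linarith)
    nlinarith
  have h2 : Real.log n ≤ Real.log (n / ε) :=
    Real.log_le_log hn0 (by rw [le_div_iff₀ hε0]; nlinarith)
  calc _ ≤ Real.log (n ^ (d + 1)) := Real.log_le_log (by positivity) h1
    _ = (d + 1) * Real.log n := by rw [Real.log_pow]; push_cast; ring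
    _ ≤ _ := by gcongr

lemma add_nine_le_two_pow (c : ℕ) : c + 9 ≤ 2 ^ (c + 4) := by
  induction c with
  | zero => norm_num
  | succ c ih =>
    have := Nat.one_le_two_pow (n := c + 4)
    rw [show c + 1 + 4 = c + 4 + 1 by ring, pow_succ]
    omega

/-- Exponent count behind `δ`: `c + 18` for the constant, `3` for `log n` and `m`, `c` for the
target, and `2 * (c + 2)` for trading `1 / ε ^ 2`; the total is `4 * c + 25`. -/
lemma additive_parameters {n ε m : ℝ} {c : ℕ} (hn : 2 ≤ n) (hε0 : 0 < ε)
    (hε : 1 ≤ ε * n ^ (c + 2)) (hm0 : 0 ≤ m) (hm : m ≤ n ^ 2) :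
    12288 * (c + 9) * Real.log n / ε ^ 3 * (m * (1 / n ^ (4 * c + 25))) ≤ 1 / (ε * n ^ c) := by
  have hn0 : 0 < n := by linarith
  have hlog : Real.log n ≤ n := by linarith [Real.log_le_sub_one_of_pos hn0]
  have hlog0 : 0 ≤ Real.log n := Real.log_nonneg (by linarith)
  have hc : (12288 * (c + 9) : ℝ) ≤ n ^ (c + 18) := by
    have h2 : ((c + 9 : ℕ) : ℝ) ≤ 2 ^ (c + 4) := by
      exact_mod_cast add_nine_le_two_pow c
    push_cast at h2
    calc (12288 * (c + 9) : ℝ) ≤ 2 ^ 14 * 2 ^ (c + 4) := by gcongr; norm_num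
      _ = 2 ^ (c + 18) := by ring
      _ ≤ n ^ (c + 18) := by gcongr
  have h1 : 12288 * (c + 9) * Real.log n * m ≤ n ^ (c + 18) * n * n ^ 2 := by gcongr
  have h2 : 1 ≤ (ε * n ^ (c + 2)) ^ 2 := one_le_pow₀ hε
  rw [div_mul_eq_mul_div, mul_one_div, mul_div_assoc', div_div, div_le_div_iff₀
    (by positivity) (by positivity), one_mul]
  calc 12288 * (c + 9) * Real.log n * m * (ε * n ^ c)
      ≤ n ^ (c + 18) * n * n ^ 2 * (ε * n ^ c) := by gcongr
    _ ≤ n ^ (c + 18) * n * n ^ 2 * (ε * n ^ c) * (ε * n ^ (c + 2)) ^ 2 :=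
        le_mul_of_one_le_right (by positivity) h2
    _ = n ^ (4 * c + 25) * ε ^ 3 := by ring

end Parameters

/-- The case of an accuracy that is polynomially large in the number of vertices. -/
theorem samplingAlgorithm_guarantee (c : ℕ) (V : Type*) [Fintype V] [DecidableEq V] {β ε : ℝ}
    (hβ0 : 0 < β) (hβ1 : β ≤ 1) (hε0 : 0 < ε) (hε1 : ε ≤ 1) (hn : 2 ≤ Fintype.card V)
    (hε : 1 ≤ ε * (Fintype.card V : ℝ) ^ (c + 2)) :
    ∃ A : RandomizedAlgorithm V, ∀ (G₀ : SimpleGraph V) (σ : List (EdgeUpdate V)),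
      (∀ t ≤ σ.length, (graphAt G₀ σ t).IsBipartite) →
      (∀ ω, A.outputAt ω G₀ σ 0 = ∅) ∧
      (∀ ω, ∀ t ≤ σ.length, IsMatchingOf (graphAt G₀ σ t) (A.outputAt ω G₀ σ t)) ∧
      (∀ t, 1 ≤ t → t ≤ σ.length →
        (1 - ε) * β * opt (graphAt G₀ σ t) ≤ A.expectedSize G₀ σ t) ∧
      A.expectedRecourse G₀ σ ≤
        196608 * (c + 9) * (4 * c + 26) * (1 / ε ^ 4) * Real.log (Fintype.card V) *
          Real.log (Fintype.card V / ε) * optRecourse β G₀ σ +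
            (σ.length : ℝ) / (ε * (Fintype.card V : ℝ) ^ c) := by
  set n : ℝ := (Fintype.card V : ℝ) with hn_def
  have hn2 : 2 ≤ n := by
    rw [hn_def]
    exact_mod_cast hn
  obtain ⟨η, hη⟩ : ∃ η, η = ε / 8 := ⟨_, rfl⟩
  have hη0 : 0 < η := by rw [hη]; positivity
  have hη1 : η ≤ 1 / 8 := by rw [hη]; linarith
  have hlog : 0 < Real.log n := Real.log_pos (by linarith)
  obtain ⟨γ, hγ⟩ : ∃ γ, γ = 4 * (c + 9) * Real.log n / η ^ 2 := ⟨_, rfl⟩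
  have hγ0 : 0 < γ := by rw [hγ]; positivity
  obtain ⟨δ, hδ⟩ : ∃ δ, δ = 1 / n ^ (4 * c + 25) := ⟨_, rfl⟩
  have hδ0 : 0 < δ := by rw [hδ]; positivity
  obtain ⟨k, hk⟩ : ∃ k, k = ⌈1 / η⌉₊ := ⟨_, rfl⟩
  have hk1 : 1 / η ≤ k := hk ▸ Nat.le_ceil _
  have hk2 : (k : ℝ) < 1 / η + 1 := hk ▸ Nat.ceil_lt_add_one (by positivity)
  have hq := failure_probability_le hn2 hε hη hη0 hγ
  refine ⟨samplingAlgorithm V δ β η γ k, fun G₀ σ hσ => ⟨fun ω => ?_, fun ω =>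
    samplingAlgorithm_isMatchingOf hδ0 hβ0.le hβ1 hη0.le hσ ω, fun t ht1 ht => ?_, ?_⟩⟩
  · simp [RandomizedAlgorithm.outputAt, samplingAlgorithm, roundRun]
  · have h := samplingAlgorithm_expectedSize (k := k) hδ0 hβ0.le hβ1 hη0 (by linarith) hγ0 hσ
      (hq.trans (by linarith)) ht1 ht
    rw [mul_assoc (1 - η)] at h
    have hκ : ((k : ℝ) + 2) / (k + 1) ≤ 1 + η := by
      rw [div_le_iff₀ (by positivity)]
      rw [div_le_iff₀ hη0] at hk1
      nlinarith
    have := size_parameters hη0 hη1 (mul_nonneg hβ0.le (opt_nonneg _))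
      (MeasureTheory.integral_nonneg fun ω => by positivity) hq hκ h
    rw [mul_assoc]
    rw [show 8 * η = ε by rw [hη]; ring] at this
    exact this
  · refine (samplingAlgorithm_expectedRecourse_le hδ0 hβ0.le hβ1 hη0 (by linarith) hγ0
      hσ).trans ?_
    have hO := optRecourse_nonneg β G₀ σ
    have hL := log_one_add_le (d := 4 * c + 25) hn2 hε0 hε1
    have hm : (Fintype.card (Sym2 V) : ℝ) ≤ n ^ 2 := by
      rw [Sym2.card, Nat.cast_choose_two, hn_def]
      push_cast
      nlinarith
    have hadd := additive_parameters hn2 hε0 hε (Nat.cast_nonneg (Fintype.card (Sym2 V))) hm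
    rw [← hδ] at hL hadd
    -- `2 * k + 2 < 2 / η + 4`, and `1 / η ≥ 8` absorbs the `4`.
    have hk3 : (2 * k + 2 : ℝ) ≤ 3 / η := by
      have : 8 ≤ 1 / η := by rw [le_div_iff₀ hη0]; linarith
      have h3 : 3 / η = 3 * (1 / η) := by ring
      linarith
    have hL0 : 0 ≤ Real.log (1 + 1 / δ) := Real.log_nonneg (by
      have : 0 < 1 / δ := by positivity
      linarith)
    push_cast at hL
    set D := optRecourse β G₀ σ
    set T : ℝ := (σ.length : ℝ)
    set m : ℝ := (Fintype.card (Sym2 V) : ℝ)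
    have hT : 0 ≤ T := Nat.cast_nonneg _
    calc (2 * k + 2) * (γ * (2 * (2 / η * Real.log (1 + 1 / δ) * D + T * (m * δ))))
        ≤ 3 / η * (γ * (2 * (2 / η * ((4 * c + 25 + 1) * Real.log (n / ε)) * D + T * (m * δ)))) := by
          gcongr
      -- Constants: `3 * 4 * 2 * 8 ^ 3 = 12288`; the chasing rate `2 / η = 16 / ε` multiplies this
      -- to `196608`.
      _ = 196608 * (c + 9) * (4 * c + 26) * (1 / ε ^ 4) * Real.log n * Real.log (n / ε) * D +
          T * (12288 * (c + 9) * Real.log n / ε ^ 3 * (m * δ)) := by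
          rw [hγ, hη]
          field_simp
          ring
      _ ≤ _ := by
          rw [div_eq_mul_one_div T]
          gcongr

end DynMatching

theorem mainTheorem6 :
    ∀ c : ℕ, ∃ C : ℝ, 0 < C ∧
      ∀ (V : Type*) [Fintype V] [DecidableEq V] (β ε : ℝ),
        0 < β → β ≤ 1 → 0 < ε → ε ≤ 1 →
        ∃ A : DynMatching.RandomizedAlgorithm V,
          ∀ (G₀ : SimpleGraph V) (σ : List (DynMatching.EdgeUpdate V)),
            (∀ t ≤ σ.length, (DynMatching.graphAt G₀ σ t).IsBipartite) →
            (∀ ω, A.outputAt ω G₀ σ 0 = ∅) ∧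
            (∀ ω, ∀ t ≤ σ.length,
              DynMatching.IsMatchingOf (DynMatching.graphAt G₀ σ t) (A.outputAt ω G₀ σ t)) ∧
            (∀ t, 1 ≤ t → t ≤ σ.length →
              (1 - ε) * β * DynMatching.opt (DynMatching.graphAt G₀ σ t) ≤
                A.expectedSize G₀ σ t) ∧
            A.expectedRecourse G₀ σ ≤
              C * (1 / ε ^ 4) * Real.log (Fintype.card V) * Real.log (Fintype.card V / ε) *
                  DynMatching.optRecourse β G₀ σ +
                (σ.length : ℝ) / (ε * (Fintype.card V : ℝ) ^ c) := by
  intro c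
  refine ⟨196608 * (c + 9) * (4 * c + 26), by positivity, fun V _ _ β ε hβ0 hβ1 hε0 hε1 => ?_⟩
  -- If the per-step additive allowance covers the trivial recourse bound, recomputation works; this
  -- includes at most one vertex. Otherwise `n * (n - 1) < n ^ 2` yields `1 ≤ ε * n ^ (c + 2)`.
  by_cases hsmall : (Fintype.card V : ℝ) * (Fintype.card V - 1) ≤
      1 / (ε * (Fintype.card V : ℝ) ^ c)
  · refine ⟨DynMatching.recomputingAlgorithm V, fun G₀ σ hσ => ⟨fun ω => ?_, fun ω =>
      DynMatching.recomputingAlgorithm_isMatchingOf hσ ω, fun t ht1 ht => ?_, ?_⟩⟩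
    · simp [DynMatching.RandomizedAlgorithm.outputAt, DynMatching.recomputingAlgorithm]
    · refine le_trans ?_ (DynMatching.recomputingAlgorithm_expectedSize hσ ht1 ht)
      have h1 : (1 - ε) * β ≤ 1 := by nlinarith
      nlinarith [DynMatching.opt_nonneg (DynMatching.graphAt G₀ σ t)]
    · refine (DynMatching.recomputingAlgorithm_expectedRecourse hσ).trans ?_
      have hlog : 0 ≤ Real.log (Fintype.card V / ε) := by
        rcases Nat.eq_zero_or_pos (Fintype.card V) with h | h
        · simp [h]
        · refine Real.log_nonneg ?_
          have : (1 : ℝ) ≤ Fintype.card V := by exact_mod_cast h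
          rw [le_div_iff₀ hε0]
          linarith
      have hO := DynMatching.optRecourse_nonneg β G₀ σ
      have hlog' : 0 ≤ Real.log (Fintype.card V) := Real.log_natCast_nonneg _
      have h1 := mul_le_mul_of_nonneg_left hsmall (Nat.cast_nonneg (α := ℝ) σ.length)
      rw [mul_one_div] at h1
      refine h1.trans (le_add_of_nonneg_left ?_)
      positivity
  · push Not at hsmall
    have hn : 2 ≤ Fintype.card V := by
      by_contra h
      have h01 : Fintype.card V = 0 ∨ Fintype.card V = 1 := by omega
      have h2 : (Fintype.card V : ℝ) * (Fintype.card V - 1) = 0 := by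
        rcases h01 with h | h <;> simp [h]
      rw [h2] at hsmall
      exact absurd hsmall (not_lt.2 (by positivity))
    refine DynMatching.samplingAlgorithm_guarantee c V hβ0 hβ1 hε0 hε1 hn ?_
    have hn0 : (0 : ℝ) < Fintype.card V := by positivity
    rw [div_lt_iff₀ (by positivity)] at hsmall
    have h3 : 0 < ε * (Fintype.card V : ℝ) ^ c := by positivity
    have h4 : ε * (Fintype.card V : ℝ) ^ (c + 2) =
        (Fintype.card V : ℝ) * Fintype.card V * (ε * (Fintype.card V : ℝ) ^ c) := by ring
    rw [h4]
    nlinarith [mul_pos hn0 h3]
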